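/- Let $X=(X_1,X_2)$ on a probability space $(\Omega,\mathcal F,\mathbb P)$ satisfy, for $t\in[0,1]$, $$dX_{1,t}=\sigma_1\,dB_{1,t}+b_1(t,\omega)\,dt,\qquad dX_{2,t}=\sigma_2\,dB_{2,t}+b_2(t,\omega)\,dt,$$ where $\sigma_1,\sigma_2>0$ are constants, $B_1,B_2,B_3$ are standard Brownian motions with $B_1$ and $B_3$ independent and $dB_{2,t}=\rho_t\,dB_{1,t}+\sqrt{1-\rho_t^2}\,dB_{3,t}$ for a deterministic function $\rho:[0,1]\to(-1,1)$. Put $\varrho:=\int_0^1\rho_t\,dt$, $\Delta^n_kX_\ell:=X_{\ell,k/n}-X_{\ell,(k-1)/n}$ and $$\varrho_1^n(X):=\frac{\sum_{k=1}^n\Delta^n_kX_1\,\Delta^n_kX_2}{\sqrt{\sum_{k=1}^n(\Delta^n_kX_1)^2\;\sum_{k=1}^n(\Delta^n_kX_2)^2}}.$$ Assume (B) $b_1,b_2\in L^\infty(dt\otimes\mathbb P)$ on $[0,1]\times\Omega$; (MDP) $\sigma_\ell^2(1-\rho_t^2)$ ($\ell=1,2$) and $\sigma_1\sigma_2(1-\rho_t^2)$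 belong to $L^2([0,1],dt)$, and $(b_n)_{n\ge1}$ is a sequence of positive numbers with $b_n\to\infty$, $b_n/\sqrt n\to0$ and $\sqrt n\,b_n\max_{1\le k\le n}\int_{(k-1)/n}^{k/n}\sigma_\ell^2\,dt\to0$ for $\ell=1,2$. Let $$\Sigma_1=\begin{pmatrix}2\int_0^1\sigma_1^4dt&2\int_0^1\sigma_1^2\sigma_2^2\rho_t^2dt&2\int_0^1\sigma_1^3\sigma_2\rho_tdt\\ 2\int_0^1\sigma_1^2\sigma_2^2\rho_t^2dt&2\int_0^1\sigma_2^4dt&2\int_0^1\sigma_1\sigma_2^3\rho_tdt\\ 2\int_0^1\sigma_1^3\sigma_2\rho_tdt&2\int_0^1\sigma_1\sigma_2^3\rho_tdt&\int_0^1\sigma_1^2\sigma_2^2(1+\rho_t^2)dt\end{pmatrix},\qquad I_{mdp}(x)=\sup_{\lambda\in\mathbb R^3}\Big(\langle\lambda,x\rangle-\tfrac12\langle\lambda,\Sigma_1\lambda\rangle\Big).$$ Then $\frac{\sqrt n}{b_n}\big(\varrho_1^n(X)-\varrho\big)$ satisfies the large deviation principle on $\mathbb R$ with speed $b_n^2$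 and rate function $$I^{\varrho}_{mdp}(u)=\inf\Big\{I_{mdp}(x,y,z):\ (x,y,z)\in\mathbb R^3,\ u=\frac{z}{\sigma_1\sigma_2}-\varrho\,\frac{\sigma_1^2y+\sigma_2^2x}{2\sigma_1^2\sigma_2^2}\Big\},$$ that is, $I^\varrho_{mdp}:\mathbb R\to[0,\infty]$ is lower semicontinuous and, with $M_n=\frac{\sqrt n}{b_n}(\varrho_1^n(X)-\varrho)$, for every Borel set $A\subset\mathbb R$ with interior $A^\circ$ and closure $\bar A$, $$-\inf_{A^\circ}I^\varrho_{mdp}\le\liminf_{n\to\infty}\frac1{b_n^2}\log\mathbb P(M_n\in A)\le\limsup_{n\to\infty}\frac1{b_n^2}\log\mathbb P(M_n\in A)\le-\inf_{\bar A}I^\varrho_{mdp}.$$ -/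

import Mathlib

open MeasureTheory ProbabilityTheory Filter Topology Set
open scoped NNReal ENNReal Matrix

noncomputable section

/-! ### Large deviation principle -/

/-- The sequence of random variables `M n` satisfies the large deviation principle on `S` with
speed `lam n` and (lower semicontinuous) rate function `I : S → [0, ∞]`. Logarithms are taken in
`[-∞, ∞]`, with `log 0 = -∞`, and the infimum over the empty set is `+∞`. -/
structure SatisfiesLDP {Ω S : Type*} [MeasurableSpace Ω] [TopologicalSpace S] [MeasurableSpace S]
    (P : Measure Ω) (M : ℕ → Ω → S) (lam : ℕ → ℝ) (I : S → ℝ≥0∞) : Prop where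
  speed : Tendsto lam atTop atTop
  lsc : LowerSemicontinuous I
  lower : ∀ A : Set S, MeasurableSet A →
    -(⨅ x ∈ interior A, (I x : EReal)) ≤
      liminf (fun n => (((lam n)⁻¹ : ℝ) : EReal) * ENNReal.log (P (M n ⁻¹' A))) atTop
  upper : ∀ A : Set S, MeasurableSet A →
    limsup (fun n => (((lam n)⁻¹ : ℝ) : EReal) * ENNReal.log (P (M n ⁻¹' A))) atTop ≤
      -(⨅ x ∈ closure A, (I x : EReal))

/-! ### Wiener integral of deterministic functions -/

/-- The step function `∑ i < N, c i 1_{(τ i, τ (i+1)]}`. -/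
def stepFunction (N : ℕ) (τ : ℕ → ℝ≥0) (c : ℕ → ℝ) (s : ℝ) : ℝ :=
  ∑ i ∈ Finset.range N, (Ioc (τ i : ℝ) (τ (i + 1) : ℝ)).indicator (fun _ => c i) s

/-- The integral over `(0, t]` of a step function against the process `B`. -/
def stepIntegral {Ω : Type*} (B : ℝ≥0 → Ω → ℝ) (N : ℕ) (τ : ℕ → ℝ≥0) (c : ℕ → ℝ) (t : ℝ≥0)
    (ω : Ω) : ℝ :=
  ∑ i ∈ Finset.range N, c i * (B (min (τ (i + 1)) t) ω - B (min (τ i) t) ω)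

/-- `J` is (a version of) the Wiener integral `∫₀ᵗ f dB` of the deterministic function
`f ∈ L²(0, t)`: it is the limit in `L²(P)` of the integrals of step functions that converge to `f`
in `L²(0, t)`. For a Brownian motion `B` this determines `J` up to almost sure equality, by the
isometry property of the integral of step functions. -/
def IsWienerIntegral {Ω : Type*} [MeasurableSpace Ω] (P : Measure Ω) (B : ℝ≥0 → Ω → ℝ)
    (f : ℝ → ℝ) (t : ℝ≥0) (J : Ω → ℝ) : Prop :=
  MemLp f 2 (volume.restrict (Ioc (0 : ℝ) t)) ∧ MemLp J 2 P ∧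
  ∃ (N : ℕ → ℕ) (τ : ℕ → ℕ → ℝ≥0) (c : ℕ → ℕ → ℝ),
    (∀ m, Monotone (τ m)) ∧
    Tendsto (fun m => eLpNorm (fun s => f s - stepFunction (N m) (τ m) (c m) s) 2
      (volume.restrict (Ioc (0 : ℝ) t))) atTop (𝓝 0) ∧
    Tendsto (fun m => eLpNorm (fun ω => J ω - stepIntegral B (N m) (τ m) (c m) t ω) 2 P)
      atTop (𝓝 0)

/-! ### The bivariate Itô model -/

/-- The model on the time interval `[0, 1]`:
`dX₁ = σ₁ dB₁ + b₁(t, ω) dt`, `dX₂ = σ₂ dB₂ + b₂(t, ω) dt`, with deterministic positive `σ₁, σ₂`,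
where `B₁, B₂, B₃` are standard Brownian motions, `B₁` and `B₃` are independent, and
`dB₂ = ρ dB₁ + √(1 - ρ²) dB₃` with a deterministic correlation `ρ` with values in `(-1, 1)`. -/
structure IsBivariateIto {Ω : Type*} [MeasurableSpace Ω] (P : Measure Ω)
    (B₁ B₂ B₃ : ℝ≥0 → Ω → ℝ) (σ₁ σ₂ ρ : ℝ → ℝ) (b₁ b₂ : ℝ → Ω → ℝ)
    (X₁ X₂ : ℝ≥0 → Ω → ℝ) : Prop where
  brownian₁ : IsBrownianReal B₁ P
  brownian₂ : IsBrownianReal B₂ P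
  brownian₃ : IsBrownianReal B₃ P
  indep : IndepFun (fun ω t => B₁ t ω) (fun ω t => B₃ t ω) P
  corr_mem : ∀ t ∈ Icc (0 : ℝ) 1, ρ t ∈ Ioo (-1 : ℝ) 1
  vol_pos₁ : ∀ t ∈ Icc (0 : ℝ) 1, 0 < σ₁ t
  vol_pos₂ : ∀ t ∈ Icc (0 : ℝ) 1, 0 < σ₂ t
  corr : ∀ t : ℝ≥0, t ≤ 1 → ∃ J₁ J₃ : Ω → ℝ,
    IsWienerIntegral P B₁ ρ t J₁ ∧ IsWienerIntegral P B₃ (fun s => √(1 - ρ s ^ 2)) t J₃ ∧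
    ∀ᵐ ω ∂P, B₂ t ω = J₁ ω + J₃ ω
  sde₁ : ∀ t : ℝ≥0, t ≤ 1 →
    IsWienerIntegral P B₁ σ₁ t (fun ω => X₁ t ω - X₁ 0 ω - ∫ s in (0 : ℝ)..t, b₁ s ω)
  sde₂ : ∀ t : ℝ≥0, t ≤ 1 →
    IsWienerIntegral P B₂ σ₂ t (fun ω => X₂ t ω - X₂ 0 ω - ∫ s in (0 : ℝ)..t, b₂ s ω)

/-- Condition (B) for one drift: `b ∈ L^∞(dt ⊗ P)` on `[0, 1] × Ω`. -/
def BoundedDrift {Ω : Type*} [MeasurableSpace Ω] (P : Measure Ω) (b : ℝ → Ω → ℝ) : Prop :=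
  MemLp (fun p : ℝ × Ω => b p.1 p.2) ∞ ((volume.restrict (Icc (0 : ℝ) 1)).prod P)

/-- Condition (MDP). -/
structure MDPCondition (σ₁ σ₂ ρ : ℝ → ℝ) (b : ℕ → ℝ) : Prop where
  memLp₁ : MemLp (fun t => σ₁ t ^ 2 * (1 - ρ t ^ 2)) 2 (volume.restrict (Icc (0 : ℝ) 1))
  memLp₂ : MemLp (fun t => σ₂ t ^ 2 * (1 - ρ t ^ 2)) 2 (volume.restrict (Icc (0 : ℝ) 1))
  memLp₁₂ : MemLp (fun t => σ₁ t * σ₂ t * (1 - ρ t ^ 2)) 2 (volume.restrict (Icc (0 : ℝ) 1))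
  pos : ∀ n, 1 ≤ n → 0 < b n
  tendsto_atTop : Tendsto b atTop atTop
  tendsto_div_sqrt : Tendsto (fun n : ℕ => b n / √n) atTop (𝓝 0)
  tendsto_max₁ : Tendsto (fun n : ℕ => √n * b n *
    ⨆ k : Fin n, ∫ t in ((k : ℝ) / n)..(((k : ℝ) + 1) / n), σ₁ t ^ 2) atTop (𝓝 0)
  tendsto_max₂ : Tendsto (fun n : ℕ => √n * b n *
    ⨆ k : Fin n, ∫ t in ((k : ℝ) / n)..(((k : ℝ) + 1) / n), σ₂ t ^ 2) atTop (𝓝 0)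

/-! ### Realized (co-)volatility and correlation -/

/-- The increment `Z_{(k+1)/n} - Z_{k/n}`. -/
def increment {Ω : Type*} (n : ℕ) (Z : ℝ≥0 → Ω → ℝ) (k : ℕ) (ω : Ω) : ℝ :=
  Z (((k : ℝ≥0) + 1) / n) ω - Z ((k : ℝ≥0) / n) ω

/-- The realized covolatility `C_t^n`. -/
def realizedCov {Ω : Type*} (n : ℕ) (t : ℝ≥0) (X₁ X₂ : ℝ≥0 → Ω → ℝ) (ω : Ω) : ℝ :=
  ∑ k ∈ Finset.range ⌊(n : ℝ≥0) * t⌋₊, increment n X₁ k ω * increment n X₂ k ω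

/-- The realized volatility `Q_t^n`. -/
def realizedVol {Ω : Type*} (n : ℕ) (t : ℝ≥0) (X : ℝ≥0 → Ω → ℝ) (ω : Ω) : ℝ :=
  ∑ k ∈ Finset.range ⌊(n : ℝ≥0) * t⌋₊, increment n X k ω ^ 2

/-- The realized correlation `ϱ_t^n = C_t^n / √(Q_{1,t}^n Q_{2,t}^n)`. -/
def realizedCorr {Ω : Type*} (n : ℕ) (t : ℝ≥0) (X₁ X₂ : ℝ≥0 → Ω → ℝ) (ω : Ω) : ℝ :=
  realizedCov n t X₁ X₂ ω / √(realizedVol n t X₁ ω * realizedVol n t X₂ ω)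

/-! ### The moderate deviation rate function -/

/-- The asymptotic covariance matrix of `√n (Q_{1,1}^n, Q_{2,1}^n, C_1^n)`. -/
def asympCov (σ₁ σ₂ ρ : ℝ → ℝ) : Matrix (Fin 3) (Fin 3) ℝ :=
  !![∫ t in (0 : ℝ)..1, 2 * σ₁ t ^ 4,
     ∫ t in (0 : ℝ)..1, 2 * (σ₁ t ^ 2 * σ₂ t ^ 2 * ρ t ^ 2),
     ∫ t in (0 : ℝ)..1, 2 * (σ₁ t ^ 3 * σ₂ t * ρ t);
     ∫ t in (0 : ℝ)..1, 2 * (σ₁ t ^ 2 * σ₂ t ^ 2 * ρ t ^ 2),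
     ∫ t in (0 : ℝ)..1, 2 * σ₂ t ^ 4,
     ∫ t in (0 : ℝ)..1, 2 * (σ₁ t * σ₂ t ^ 3 * ρ t);
     ∫ t in (0 : ℝ)..1, 2 * (σ₁ t ^ 3 * σ₂ t * ρ t),
     ∫ t in (0 : ℝ)..1, 2 * (σ₁ t * σ₂ t ^ 3 * ρ t),
     ∫ t in (0 : ℝ)..1, σ₁ t ^ 2 * σ₂ t ^ 2 * (1 + ρ t ^ 2)]

/-- `I_mdp(x) = sup_l (⟨l, x⟩ - ⟨l, Σ l⟩ / 2)`. The vector `l = 0` contributes `0`, so truncating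
the terms at `0` does not change the supremum. -/
def rateMDP (σ₁ σ₂ ρ : ℝ → ℝ) (x : Fin 3 → ℝ) : ℝ≥0∞ :=
  ⨆ l : Fin 3 → ℝ, ENNReal.ofReal (l ⬝ᵥ x - 1 / 2 * (l ⬝ᵥ (asympCov σ₁ σ₂ ρ *ᵥ l)))

/-- The infimum of `I_mdp(x, y, z)` over all `(x, y, z)` with
`u = z / (σ₁ σ₂) - ϱ (σ₁² y + x σ₂²) / (2 σ₁² σ₂²)`, for constant `σ₁, σ₂` and `ϱ = ∫₀¹ ρ_t dt`. -/
def rateCorr (σ₁ σ₂ : ℝ) (ρ : ℝ → ℝ) (u : ℝ) : ℝ≥0∞ :=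
  ⨅ (x : ℝ) (y : ℝ) (z : ℝ)
    (_ : u = z / (σ₁ * σ₂) -
      (∫ t in (0 : ℝ)..1, ρ t) * ((σ₁ ^ 2 * y + x * σ₂ ^ 2) / (2 * σ₁ ^ 2 * σ₂ ^ 2))),
    rateMDP (fun _ => σ₁) (fun _ => σ₂) ρ ![x, y, z]

end

/-!
The normalized realized correlation is, up to an error that is negligible at every exponential
rate, a quadratic functional of a Gaussian vector whose cumulant generating function is explicit.

*Linearization.* Let `r = ∫ ρ`. After division by the volatilities, the increments of `X₁`, `X₂` are
those of `B₁`, `B₂` up to a drift of size `O(1 / n)`, which changes the realized (co-)volatilities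
by `O(1 / √n)`. The map `(q₁, q₂, c) ↦ c / √(q₁ q₂)` has differential
`c - r (q₁ + q₂) / 2` at `(1, 1, r)` and a quadratic remainder
(`abs_div_sqrt_sub_linear_le`). Since the realized (co-)volatilities of `B₁`, `B₂` are exponentially
tight at the scale `b n / √n`, both errors are of order `b n / √n + 1 / b n` outside of an event of
probability `exp (-C * b n ^ 2)` with `C` arbitrary (`abs_scaled_corr_sub_linear_le`,
`IsBivariateIto.expEquiv`). Only a one-dimensional statistic remains, and no contraction principle
is needed.

*The linearized statistic.* In terms of the increments `p k`, `q k` of `B₁ + B₂` and `B₁ - B₂` it is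
`∑ (1 - r) / 4 * p k ^ 2 - (1 + r) / 4 * q k ^ 2`. All these increments lie in one closed subspace of
`L²(P)` consisting of centered Gaussian variables (`IsBivariateIto.isGaussianSubspace`), namely the
one generated by the independent Brownian motions `B₁` and `B₃`, and they are orthogonal, hence
independent. Expanding the cumulant generating function of the `χ²` law to third order
(`IsGaussianSubspace.abs_cgf_quadratic_sub_le`) shows that the scaled cumulant generating functions
converge to that of a Gaussian of variance `corrVariance r m`, where `m = ∫ ρ²`
(`IsBivariateIto.hasQuadraticCGFLimit`); the convergence of the variances is Lebesgue's
differentiation theorem (`tendsto_mul_sum_sq_integral`).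

*Large deviations.* A quadratic limiting cumulant generating function gives the upper bound by
Chernoff's inequality and the lower bound by exponential tilting
(`HasQuadraticCGFLimit.upper_tail`, `HasQuadraticCGFLimit.lower_ball`,
`HasQuadraticCGFLimit.satisfiesLDP_of_expEquiv`). Finally the variational formula for the rate
function is solved explicitly (`rateCorr_eq`): it equals `u ↦ u² / (2 * corrVariance r m)`.
-/

/-! ### Large deviations from a quadratic limiting cumulant generating function -/

section GartnerEllis

variable {Ω : Type*} [MeasurableSpace Ω] {P : Measure Ω} {L : ℕ → Ω → ℝ} {a : ℕ → ℝ}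
  {v : ℝ}

/-- The scaled cumulant generating functions of `L n` at speed `a n` converge pointwise to that of
a centered Gaussian of variance `v`. Integrability is part of the notion since `cgf` takes a junk
value otherwise. -/
def HasQuadraticCGFLimit (P : Measure Ω) (L : ℕ → Ω → ℝ) (a : ℕ → ℝ) (v : ℝ) : Prop :=
  ∀ l : ℝ, (∀ᶠ n in atTop, Integrable (fun ω => Real.exp (a n * l * L n ω)) P) ∧
    Tendsto (fun n => (a n)⁻¹ * cgf (L n) P (a n * l)) atTop (𝓝 (v * l ^ 2 / 2))

lemma HasQuadraticCGFLimit.neg (h : HasQuadraticCGFLimit P L a v) :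
    HasQuadraticCGFLimit P (fun n => -L n) a v := by
  intro l
  obtain ⟨h1, h2⟩ := h (-l)
  refine ⟨?_, ?_⟩
  · filter_upwards [h1] with n hn
    simpa using hn
  · simpa [cgf_neg] using h2

lemma HasQuadraticCGFLimit.eventually_cgf_le (h : HasQuadraticCGFLimit P L a v)
    (ha : Tendsto a atTop atTop) (l : ℝ) {η : ℝ} (hη : 0 < η) :
    ∀ᶠ n in atTop, cgf (L n) P (a n * l) ≤ a n * (v * l ^ 2 / 2 + η) := by
  filter_upwards [(h l).2.eventually_le_const (show v * l ^ 2 / 2 < v * l ^ 2 / 2 + η by linarith),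
    ha.eventually_gt_atTop 0] with n hn h0
  rwa [inv_mul_le_iff₀ h0] at hn

lemma HasQuadraticCGFLimit.eventually_le_cgf (h : HasQuadraticCGFLimit P L a v)
    (ha : Tendsto a atTop atTop) (l : ℝ) {η : ℝ} (hη : 0 < η) :
    ∀ᶠ n in atTop, a n * (v * l ^ 2 / 2 - η) ≤ cgf (L n) P (a n * l) := by
  filter_upwards [(h l).2.eventually_const_le (show v * l ^ 2 / 2 - η < v * l ^ 2 / 2 by linarith),
    ha.eventually_gt_atTop 0] with n hn h0
  rwa [le_inv_mul_iff₀ h0] at hn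

/-- Chernoff's bound. -/
lemma HasQuadraticCGFLimit.upper_tail [IsProbabilityMeasure P] (h : HasQuadraticCGFLimit P L a v)
    (ha : Tendsto a atTop atTop) (hv : 0 < v) {x η : ℝ} (hx : 0 < x) (hη : 0 < η) :
    ∀ᶠ n in atTop, P.real {ω | x ≤ L n ω} ≤ Real.exp (-(a n * (x ^ 2 / (2 * v) - η))) := by
  filter_upwards [(h (x / v)).1, h.eventually_cgf_le ha (x / v) hη,
    ha.eventually_gt_atTop 0] with n h1 h2 h3
  refine (measure_ge_le_exp_cgf x (by positivity) h1).trans (Real.exp_le_exp.2 ?_)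
  have : a n * (v * (x / v) ^ 2 / 2 + η) - a n * (x / v) * x
      = -(a n * (x ^ 2 / (2 * v) - η)) := by field_simp; ring
  linarith

lemma HasQuadraticCGFLimit.abs_tail [IsProbabilityMeasure P] (h : HasQuadraticCGFLimit P L a v)
    (ha : Tendsto a atTop atTop) (hv : 0 < v) {x η : ℝ} (hx : 0 < x) (hη : 0 < η) :
    ∀ᶠ n in atTop, P.real {ω | x ≤ |L n ω|} ≤
      Real.exp (-(a n * (x ^ 2 / (2 * v) - η))) := by
  filter_upwards [h.upper_tail ha hv hx (half_pos hη), h.neg.upper_tail ha hv hx (half_pos hη),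
    ha.eventually_ge_atTop (2 / η)] with n h1 h2 h3
  have hs : {ω | x ≤ |L n ω|} ⊆ {ω | x ≤ L n ω} ∪ {ω | x ≤ (-L n) ω} := by
    intro ω hω
    simpa [le_abs] using hω
  refine (measureReal_mono hs).trans ((measureReal_union_le _ _).trans ?_)
  have h4 : 1 ≤ a n * (η / 2) := by
    rw [div_le_iff₀ hη] at h3; linarith
  have h5 : 2 * Real.exp (-(a n * (x ^ 2 / (2 * v) - η / 2))) ≤
      Real.exp (-(a n * (x ^ 2 / (2 * v) - η))) := by
    have : -(a n * (x ^ 2 / (2 * v) - η)) =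
      a n * (η / 2) + -(a n * (x ^ 2 / (2 * v) - η / 2)) := by ring
    rw [this, Real.exp_add]
    gcongr
    linarith [Real.add_one_le_exp (a n * (η / 2))]
  linarith

/-- The lower bound, by exponential tilting: under the measure with density proportional to
`exp (a n * l * L n)`, `l = u / v`, Chernoff's bound shows that `L n` concentrates at `u`. -/
lemma HasQuadraticCGFLimit.lower_ball [IsProbabilityMeasure P]
    (h : HasQuadraticCGFLimit P L a v)
    (hL : ∀ n, AEMeasurable (L n) P)
    (ha : Tendsto a atTop atTop) (hv : 0 < v) (u : ℝ) {ε η : ℝ} (hε : 0 < ε) (hη : 0 < η) :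
    ∀ᶠ n in atTop, Real.exp (-(a n * (u ^ 2 / (2 * v) + η))) ≤
      P.real {ω | |L n ω - u| < ε} := by
  set l := u / v with hl
  obtain ⟨e, he0, heε, he1, he2⟩ : ∃ e > 0, e ≤ ε ∧ |l| * e ≤ η / 2 ∧
      2 * (e ^ 2 / (8 * v)) ≤ η / 2 := by
    have t1 : Tendsto (fun e : ℝ => |l| * e) (𝓝[>] 0) (𝓝 0) :=
      ((continuous_const.mul continuous_id).tendsto' 0 0 (by simp)).mono_left nhdsWithin_le_nhds
    have t2 : Tendsto (fun e : ℝ => 2 * (e ^ 2 / (8 * v))) (𝓝[>] 0) (𝓝 0) :=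
      ((by fun_prop : Continuous fun e : ℝ => 2 * (e ^ 2 / (8 * v))).tendsto' 0 0
        (by simp)).mono_left nhdsWithin_le_nhds
    have t3 : Tendsto (fun e : ℝ => e) (𝓝[>] 0) (𝓝 0) := tendsto_id.mono_left nhdsWithin_le_nhds
    obtain ⟨e, h1, h2, h3, h4⟩ := ((t1.eventually_le_const (half_pos hη)).and
      ((t2.eventually_le_const (half_pos hη)).and ((t3.eventually_le_const hε).and
        self_mem_nhdsWithin))).exists
    exact ⟨e, h4, h3, h1, h2⟩
  -- `m` is optimal in Chernoff's bound for deviations of size `e` under the tilted measure, and the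
  -- resulting rate `e ^ 2 / (2 * v) = 4 * κ` leaves room for errors `κ` in the limits below
  set m := e / v with hm
  set κ := e ^ 2 / (8 * v) with hκ
  have hκ0 : 0 < κ := by positivity
  filter_upwards [(h l).1, (h (l + m)).1, (h (l - m)).1, h.eventually_le_cgf ha l hκ0,
    h.eventually_cgf_le ha (l + m) hκ0, h.eventually_cgf_le ha (l - m) hκ0,
    ha.eventually_gt_atTop 0, ha.eventually_ge_atTop (2 / κ)] with n i1 i2 i3 c1 c2 c3 a0 aκ
  set A := {ω | |L n ω - u| < e} with hA
  have hAm : NullMeasurableSet A P :=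
    nullMeasurableSet_lt ((hL n).sub_const u).norm aemeasurable_const
  -- off the ball of radius `e`, the density is dominated by its tilts by `±m`
  have hpt : ∀ ω, Real.exp (a n * l * L n ω) ≤
      A.indicator (fun _ => Real.exp (a n * (l * u + |l| * e))) ω +
      (Real.exp (-(a n * m * (u + e))) * Real.exp (a n * (l + m) * L n ω) +
       Real.exp (a n * m * (u - e)) * Real.exp (a n * (l - m) * L n ω)) := by
    intro ω
    rw [← Real.exp_add, ← Real.exp_add]
    by_cases hω : ω ∈ A
    · rw [indicator_of_mem hω]
      have h1 : Real.exp (a n * l * L n ω) ≤ Real.exp (a n * (l * u + |l| * e)) := by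
        apply Real.exp_le_exp.2
        rw [mul_assoc]
        gcongr
        have : l * (L n ω - u) ≤ |l| * e := by
          refine (le_abs_self _).trans ?_
          rw [abs_mul]
          gcongr
          exact le_of_lt hω
        linarith
      have := Real.exp_pos (-(a n * m * (u + e)) + a n * (l + m) * L n ω)
      have := Real.exp_pos (a n * m * (u - e) + a n * (l - m) * L n ω)
      linarith
    · rw [indicator_of_notMem hω, zero_add]
      have hω' : e ≤ |L n ω - u| := not_lt.1 hω
      have hm0 : 0 ≤ a n * m := by positivity
      rcases le_abs.1 hω' with h1 | h1
      · have : Real.exp (a n * l * L n ω) ≤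
            Real.exp (-(a n * m * (u + e)) + a n * (l + m) * L n ω) := by
          apply Real.exp_le_exp.2
          nlinarith
        linarith [Real.exp_pos (a n * m * (u - e) + a n * (l - m) * L n ω)]
      · have : Real.exp (a n * l * L n ω) ≤
            Real.exp (a n * m * (u - e) + a n * (l - m) * L n ω) := by
          apply Real.exp_le_exp.2
          nlinarith
        linarith [Real.exp_pos (-(a n * m * (u + e)) + a n * (l + m) * L n ω)]
  have hint : mgf (L n) P (a n * l) ≤ P.real A * Real.exp (a n * (l * u + |l| * e)) +
      (Real.exp (-(a n * m * (u + e))) * mgf (L n) P (a n * (l + m)) +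
       Real.exp (a n * m * (u - e)) * mgf (L n) P (a n * (l - m))) := by
    have iA : Integrable (A.indicator (fun _ => Real.exp (a n * (l * u + |l| * e)))) P :=
      (integrable_const _).indicator₀ hAm
    have i23 : Integrable (fun ω => Real.exp (-(a n * m * (u + e))) *
        Real.exp (a n * (l + m) * L n ω) +
        Real.exp (a n * m * (u - e)) * Real.exp (a n * (l - m) * L n ω)) P :=
      (i2.const_mul _).add (i3.const_mul _)
    have := integral_mono i1 (iA.add i23) hpt
    simp only [Pi.add_apply] at this
    rw [integral_add iA i23,
      integral_add (i2.const_mul _) (i3.const_mul _), integral_const_mul, integral_const_mul,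
      integral_indicator₀ hAm, setIntegral_const, smul_eq_mul] at this
    exact this
  rw [← exp_cgf i1, ← exp_cgf i2, ← exp_cgf i3, ← Real.exp_add, ← Real.exp_add] at hint
  have e1 : Real.exp (a n * (v * l ^ 2 / 2 - κ)) ≤ Real.exp (cgf (L n) P (a n * l)) :=
    Real.exp_le_exp.2 c1
  have e2 : Real.exp (-(a n * m * (u + e)) + cgf (L n) P (a n * (l + m))) ≤
      Real.exp (a n * (v * l ^ 2 / 2 - 3 * κ)) := by
    apply Real.exp_le_exp.2
    have : a n * (v * (l + m) ^ 2 / 2 + κ) - a n * m * (u + e) =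
        a n * (v * l ^ 2 / 2 - 3 * κ) := by
      simp only [hl, hm, hκ]; field_simp; ring
    linarith
  have e3 : Real.exp (a n * m * (u - e) + cgf (L n) P (a n * (l - m))) ≤
      Real.exp (a n * (v * l ^ 2 / 2 - 3 * κ)) := by
    apply Real.exp_le_exp.2
    have : a n * (v * (l - m) ^ 2 / 2 + κ) + a n * m * (u - e) =
        a n * (v * l ^ 2 / 2 - 3 * κ) := by
      simp only [hl, hm, hκ]; field_simp; ring
    linarith
  have haκ : 2 ≤ a n * κ := by rwa [div_le_iff₀ hκ0] at aκ
  have e4 : Real.exp (a n * (v * l ^ 2 / 2 - 2 * κ)) +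
      2 * Real.exp (a n * (v * l ^ 2 / 2 - 3 * κ)) ≤ Real.exp (a n * (v * l ^ 2 / 2 - κ)) := by
    have r1 : a n * (v * l ^ 2 / 2 - κ) = a n * (v * l ^ 2 / 2 - 2 * κ) + a n * κ := by ring
    have r2 : a n * (v * l ^ 2 / 2 - 3 * κ) = a n * (v * l ^ 2 / 2 - 2 * κ) + -(a n * κ) := by ring
    rw [r1, r2, Real.exp_add, Real.exp_add]
    have s1 := Real.add_one_le_exp (a n * κ)
    have s2 : Real.exp (-(a n * κ)) ≤ 1 := Real.exp_le_one_iff.2 (by linarith)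
    nlinarith [Real.exp_pos (a n * (v * l ^ 2 / 2 - 2 * κ))]
  have e5 : Real.exp (a n * (v * l ^ 2 / 2 - 2 * κ)) ≤
      P.real A * Real.exp (a n * (l * u + |l| * e)) := by linarith
  have e6 : Real.exp (a n * (v * l ^ 2 / 2 - 2 * κ) - a n * (l * u + |l| * e)) ≤ P.real A := by
    rw [Real.exp_sub, div_le_iff₀ (Real.exp_pos _)]
    exact e5
  refine le_trans (Real.exp_le_exp.2 ?_) (e6.trans (measureReal_mono fun ω hω => ?_))
  · have r : v * l ^ 2 / 2 - l * u = -(u ^ 2 / (2 * v)) := by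
      simp only [hl]; field_simp; ring
    have : a n * (v * l ^ 2 / 2 - 2 * κ) - a n * (l * u + |l| * e) =
      -(a n * (u ^ 2 / (2 * v) + (2 * κ + |l| * e))) := by linear_combination a n * r
    rw [this]
    have : a n * (u ^ 2 / (2 * v) + (2 * κ + |l| * e)) ≤ a n * (u ^ 2 / (2 * v) + η) := by
      gcongr; linarith
    linarith
  · exact lt_of_lt_of_le hω heε

end GartnerEllis

/-! ### From tail estimates to the large deviation principle -/

section Conversion

variable {Ω : Type*} [MeasurableSpace Ω] {P : Measure Ω} {L M : ℕ → Ω → ℝ} {a : ℕ → ℝ}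
  {v : ℝ}

lemma inv_mul_log_le {p : ℝ≥0∞} {c y : ℝ} (hc : 0 < c)
    (h : p ≤ ENNReal.ofReal (Real.exp (-(c * y)))) :
    ((c⁻¹ : ℝ) : EReal) * ENNReal.log p ≤ ((-y : ℝ) : EReal) := by
  have h1 : ENNReal.log p ≤ ((-(c * y) : ℝ) : EReal) := by
    refine (ENNReal.log_le_log h).trans ?_
    rw [ENNReal.log_ofReal_of_pos (Real.exp_pos _), Real.log_exp]
  refine (mul_le_mul_of_nonneg_left h1 (by exact_mod_cast (inv_pos.2 hc).le)).trans ?_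
  rw [← EReal.coe_mul]
  apply le_of_eq
  congr 1
  field_simp

lemma le_inv_mul_log {p : ℝ≥0∞} {c y : ℝ} (hc : 0 < c)
    (h : ENNReal.ofReal (Real.exp (-(c * y))) ≤ p) :
    ((-y : ℝ) : EReal) ≤ ((c⁻¹ : ℝ) : EReal) * ENNReal.log p := by
  have h1 : ((-(c * y) : ℝ) : EReal) ≤ ENNReal.log p := by
    refine le_trans ?_ (ENNReal.log_le_log h)
    rw [ENNReal.log_ofReal_of_pos (Real.exp_pos _), Real.log_exp]
  refine le_trans ?_ (mul_le_mul_of_nonneg_left h1 (by exact_mod_cast (inv_pos.2 hc).le))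
  rw [← EReal.coe_mul]
  apply le_of_eq
  congr 1
  field_simp

/-- On the line, a Gaussian rate function is monotone on both half-lines, so that the large
deviation principle reduces to two-sided tails and to small balls. -/
theorem satisfiesLDP_of_tail_of_ball [IsProbabilityMeasure P]
    (ha : Tendsto a atTop atTop) (hv : 0 < v)
    (hup : ∀ x η : ℝ, 0 < x → 0 < η → ∀ᶠ n in atTop,
      P {ω | x ≤ |M n ω|} ≤ ENNReal.ofReal (Real.exp (-(a n * (x ^ 2 / (2 * v) - η)))))
    (hlo : ∀ u ε η : ℝ, 0 < ε → 0 < η → ∀ᶠ n in atTop,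
      ENNReal.ofReal (Real.exp (-(a n * (u ^ 2 / (2 * v) + η)))) ≤ P {ω | |M n ω - u| < ε}) :
    SatisfiesLDP P M a (fun u => ENNReal.ofReal (u ^ 2 / (2 * v))) where
  speed := ha
  lsc := (ENNReal.continuous_ofReal.comp (by fun_prop)).lowerSemicontinuous
  lower A _ := by
    have key : ∀ u ∈ interior A, -(((u ^ 2 / (2 * v) : ℝ)) : EReal) ≤
        liminf (fun n => (((a n)⁻¹ : ℝ) : EReal) * ENNReal.log (P (M n ⁻¹' A))) atTop := by
      intro u hu
      obtain ⟨ε, hε, hball⟩ := Metric.mem_nhds_iff.1 (mem_interior_iff_mem_nhds.1 hu)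
      rw [← EReal.coe_neg]
      refine EReal.ge_of_forall_gt_iff_ge.1 fun z hz => ?_
      have hz' : z < -(u ^ 2 / (2 * v)) := by exact_mod_cast hz
      refine le_liminf_of_le (by isBoundedDefault) ?_
      filter_upwards [hlo u ε (-(u ^ 2 / (2 * v)) - z) hε (by linarith),
        ha.eventually_gt_atTop 0] with n hn h0
      have := le_inv_mul_log h0 (hn.trans (measure_mono (t := M n ⁻¹' A) fun ω hω =>
        hball (by simpa [Real.dist_eq] using hω)))
      convert this using 2
      ring
    rw [EReal.neg_le]
    refine le_iInf₂ fun u hu => ?_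
    rw [EReal.neg_le]
    convert key u hu using 2
    rw [EReal.coe_ennreal_ofReal, max_eq_left (by positivity)]
  upper A _ := by
    have hbd : ∀ y : ℝ, (y : EReal) <
          ⨅ x ∈ closure A, ((ENNReal.ofReal (x ^ 2 / (2 * v)) : ℝ≥0∞) : EReal) →
        limsup (fun n => (((a n)⁻¹ : ℝ) : EReal) * ENNReal.log (P (M n ⁻¹' A))) atTop ≤
          ((-y : ℝ) : EReal) := by
      intro y hy
      refine EReal.le_of_forall_lt_iff_le.1 fun z hz => ?_
      have hz' : -y < z := by exact_mod_cast hz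
      refine limsup_le_of_le (by isBoundedDefault) ?_
      rcases le_or_gt y 0 with hy0 | hy0
      · filter_upwards [ha.eventually_gt_atTop 0] with n h0
        have : P (M n ⁻¹' A) ≤ ENNReal.ofReal (Real.exp (-(a n * 0))) := by
          simpa using prob_le_one
        refine (inv_mul_log_le h0 this).trans ?_
        exact_mod_cast (by linarith : -(0 : ℝ) ≤ z)
      · -- `A` avoids the sublevel set of height `y`, which is an interval around `0`
        have hA : ∀ x ∈ A, √(2 * v * y) ≤ |x| := by
          intro x hx
          have h1 := hy.trans_le (iInf₂_le x (subset_closure hx))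
          rw [EReal.coe_ennreal_ofReal, max_eq_left (by positivity)] at h1
          have h2 : y < x ^ 2 / (2 * v) := by exact_mod_cast h1
          rw [lt_div_iff₀ (by positivity)] at h2
          rw [← Real.sqrt_sq_eq_abs]
          exact Real.sqrt_le_sqrt (by linarith)
        filter_upwards [hup (√(2 * v * y)) (y + z) (by positivity) (by linarith),
          ha.eventually_gt_atTop 0] with n hn h0
        have := inv_mul_log_le h0 ((measure_mono (s := M n ⁻¹' A) fun ω hω => hA _ hω).trans hn)
        convert this using 2
        rw [Real.sq_sqrt (by positivity)]
        field_simp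
        ring
    refine EReal.le_of_forall_lt_iff_le.1 fun z hz => ?_
    have := hbd (-z) (by
      rw [EReal.coe_neg]
      exact EReal.neg_lt_comm.1 hz)
    simpa using this

/-- The conclusion holds for every sequence that is exponentially equivalent, at the speed `a`,
to one with a quadratic limiting cumulant generating function. -/
theorem HasQuadraticCGFLimit.satisfiesLDP_of_expEquiv [IsProbabilityMeasure P]
    (h : HasQuadraticCGFLimit P L a v)
    (hL : ∀ n, AEMeasurable (L n) P) (ha : Tendsto a atTop atTop) (hv : 0 < v)
    (hLM : ∀ δ K : ℝ, 0 < δ → ∀ᶠ n in atTop,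
      P {ω | δ ≤ |M n ω - L n ω|} ≤ ENNReal.ofReal (Real.exp (-(a n * K)))) :
    SatisfiesLDP P M a (fun u => ENNReal.ofReal (u ^ 2 / (2 * v))) := by
  refine satisfiesLDP_of_tail_of_ball ha hv (fun x η hx hη => ?_) (fun u ε η hε hη => ?_)
  · -- shrink `x` to some `y < x` with `y² / 2v > x² / 2v - η / 3`
    obtain ⟨y, hy0, hyx, hy⟩ : ∃ y, 0 < y ∧ y < x ∧ x ^ 2 / (2 * v) - η / 3 < y ^ 2 / (2 * v) := by
      have t : Tendsto (fun y : ℝ => y ^ 2 / (2 * v)) (𝓝[<] x) (𝓝 (x ^ 2 / (2 * v))) :=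
        ((by fun_prop : Continuous fun y : ℝ => y ^ 2 / (2 * v)).tendsto x).mono_left
          nhdsWithin_le_nhds
      obtain ⟨y, h1, h2, h3⟩ := ((t.eventually_const_lt (by linarith :
        x ^ 2 / (2 * v) - η / 3 < x ^ 2 / (2 * v))).and
          (((eventually_gt_nhds hx).filter_mono nhdsWithin_le_nhds).and
            self_mem_nhdsWithin)).exists
      exact ⟨y, h2, h3, h1⟩
    filter_upwards [h.abs_tail ha hv hy0 (by positivity : 0 < η / 3),
      hLM (x - y) (x ^ 2 / (2 * v)) (by linarith), ha.eventually_gt_atTop 0,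
      ha.eventually_ge_atTop (3 / η)] with n h1 h2 h0 h3
    have hs : {ω | x ≤ |M n ω|} ⊆ {ω | y ≤ |L n ω|} ∪ {ω | x - y ≤ |M n ω - L n ω|} := by
      intro ω hω
      by_contra hc
      simp only [mem_union, mem_ofPred_eq, not_or, not_le] at hc hω
      have := abs_sub_abs_le_abs_sub (M n ω) (L n ω)
      linarith
    refine (measure_mono hs).trans ((measure_union_le _ _).trans ?_)
    have h1' : P {ω | y ≤ |L n ω|} ≤
        ENNReal.ofReal (Real.exp (-(a n * (y ^ 2 / (2 * v) - η / 3)))) := by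
      rw [← ofReal_measureReal (measure_ne_top _ _)]
      exact ENNReal.ofReal_le_ofReal h1
    refine (add_le_add h1' h2).trans ?_
    rw [← ENNReal.ofReal_add (Real.exp_pos _).le (Real.exp_pos _).le]
    apply ENNReal.ofReal_le_ofReal
    have h4 : 1 ≤ a n * (η / 3) := by
      rw [div_le_iff₀ hη] at h3; linarith
    set E := Real.exp (-(a n * (x ^ 2 / (2 * v) - 2 * η / 3))) with hE
    have k1 : Real.exp (-(a n * (y ^ 2 / (2 * v) - η / 3))) ≤ E := by
      apply Real.exp_le_exp.2
      nlinarith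
    have k2 : Real.exp (-(a n * (x ^ 2 / (2 * v)))) ≤ E := by
      apply Real.exp_le_exp.2
      nlinarith
    have k3 : 2 * E ≤ Real.exp (-(a n * (x ^ 2 / (2 * v) - η))) := by
      have : -(a n * (x ^ 2 / (2 * v) - η)) =
        a n * (η / 3) + -(a n * (x ^ 2 / (2 * v) - 2 * η / 3)) := by ring
      rw [this, Real.exp_add]
      gcongr
      linarith [Real.add_one_le_exp (a n * (η / 3))]
    linarith
  · filter_upwards [h.lower_ball hL ha hv u (half_pos hε) (half_pos hη),
      hLM (ε / 2) (u ^ 2 / (2 * v) + η) (half_pos hε), ha.eventually_gt_atTop 0,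
      ha.eventually_ge_atTop (2 / η)] with n h1 h2 h0 h3
    have hs : {ω | |L n ω - u| < ε / 2} ⊆
        {ω | |M n ω - u| < ε} ∪ {ω | ε / 2 ≤ |M n ω - L n ω|} := by
      intro ω hω
      by_contra hc
      simp only [mem_union, mem_ofPred_eq, not_or, not_le, not_lt] at hc hω
      have := abs_sub_le (M n ω) (L n ω) u
      linarith
    have h4 := ((measure_mono hs).trans (measure_union_le _ _)).trans (add_le_add_right h2 _)
    have h1' : ENNReal.ofReal (Real.exp (-(a n * (u ^ 2 / (2 * v) + η / 2)))) ≤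
        P {ω | |L n ω - u| < ε / 2} := by
      rw [← ofReal_measureReal (measure_ne_top _ _)]
      exact ENNReal.ofReal_le_ofReal h1
    have h5 := tsub_le_iff_right.2 (h1'.trans h4)
    refine le_trans ?_ h5
    rw [← ENNReal.ofReal_sub _ (Real.exp_pos _).le]
    apply ENNReal.ofReal_le_ofReal
    have h6 : 1 ≤ a n * (η / 2) := by
      rw [div_le_iff₀ hη] at h3; linarith
    have : -(a n * (u ^ 2 / (2 * v) + η / 2)) =
      a n * (η / 2) + -(a n * (u ^ 2 / (2 * v) + η)) := by ring
    rw [this, Real.exp_add]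
    nlinarith [Real.add_one_le_exp (a n * (η / 2)), Real.exp_pos (-(a n * (u ^ 2 / (2 * v) + η)))]

end Conversion

/-! ### Gaussian subspaces of `L²` -/

section GaussianSubspace

variable {Ω : Type*} [MeasurableSpace Ω] {P : Measure Ω}

/-- Every element of the subspace `G` of `L²(P)` is a centered Gaussian random variable. As `G` is
stable under scaling, the value at `1` of the characteristic functions suffices. -/
def IsGaussianSubspace (G : Submodule ℝ (Lp ℝ 2 P)) : Prop :=
  ∀ X ∈ G, ∫ ω, Complex.exp (Complex.I * (X ω : ℂ)) ∂P = Complex.exp (-(‖X‖ ^ 2 / 2 : ℝ))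

lemma integrable_cexp_I_mul [IsProbabilityMeasure P] {f : Ω → ℝ} (hf : AEStronglyMeasurable f P) :
    Integrable (fun ω => Complex.exp (Complex.I * (f ω : ℂ))) P := by
  refine Integrable.of_bound (C := 1) ?_ (ae_of_all _ fun ω => ?_)
  · exact Complex.continuous_exp.comp_aestronglyMeasurable
      ((Complex.continuous_ofReal.comp_aestronglyMeasurable hf).const_mul _)
  · rw [mul_comm, Complex.norm_exp_ofReal_mul_I]

/-- The value at `1` of the characteristic function is `1`-Lipschitz on `L²(P)`. -/
lemma continuous_integral_cexp_I_mul [IsProbabilityMeasure P] :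
    Continuous fun X : Lp ℝ 2 P => ∫ ω, Complex.exp (Complex.I * (X ω : ℂ)) ∂P := by
  refine (LipschitzWith.of_dist_le_mul (K := 1) fun X Y => ?_).continuous
  have hX := (Lp.aestronglyMeasurable X)
  have hY := (Lp.aestronglyMeasurable Y)
  have hXY : Integrable (fun ω => X ω - Y ω) P :=
    ((Lp.memLp X).sub (Lp.memLp Y)).integrable (by norm_num)
  rw [dist_eq_norm, ← integral_sub (integrable_cexp_I_mul hX) (integrable_cexp_I_mul hY)]
  refine (norm_integral_le_of_norm_le hXY.norm (ae_of_all _ fun ω => ?_)).trans ?_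
  · have : Complex.exp (Complex.I * (X ω : ℂ)) - Complex.exp (Complex.I * (Y ω : ℂ)) =
        Complex.exp ((Y ω : ℂ) * Complex.I) *
          (Complex.exp (Complex.I * ((X ω - Y ω : ℝ) : ℂ)) - 1) := by
      rw [mul_sub, ← Complex.exp_add, mul_one, mul_comm Complex.I (Y ω : ℂ)]
      congr 2
      push_cast
      ring
    rw [this, norm_mul, Complex.norm_exp_ofReal_mul_I, one_mul]
    exact Real.norm_exp_I_mul_ofReal_sub_one_le
  · have h1 : eLpNorm (fun ω => X ω - Y ω) 1 P ≤ eLpNorm (fun ω => X ω - Y ω) 2 P :=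
      eLpNorm_le_eLpNorm_of_exponent_le (by norm_num) (hX.sub hY)
    rw [integral_norm_eq_lintegral_enorm hXY.aestronglyMeasurable,
      ← eLpNorm_one_eq_lintegral_enorm, NNReal.coe_one, one_mul, dist_eq_norm, Lp.norm_def]
    have h2 : eLpNorm (fun ω => X ω - Y ω) 2 P = eLpNorm (X - Y : Lp ℝ 2 P) 2 P :=
      eLpNorm_congr_ae (Lp.coeFn_sub X Y).symm
    rw [← h2]
    exact ENNReal.toReal_mono (by rw [h2]; exact Lp.eLpNorm_ne_top _) h1

/-- An `L²`-limit of centered Gaussian variables is a centered Gaussian variable. -/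
lemma IsGaussianSubspace.topologicalClosure [IsProbabilityMeasure P]
    {G : Submodule ℝ (Lp ℝ 2 P)} (hG : IsGaussianSubspace G) :
    IsGaussianSubspace G.topologicalClosure := by
  have hc : IsClosed {X : Lp ℝ 2 P | ∫ ω, Complex.exp (Complex.I * (X ω : ℂ)) ∂P =
      Complex.exp (-(‖X‖ ^ 2 / 2 : ℝ))} :=
    isClosed_eq continuous_integral_cexp_I_mul
      (Complex.continuous_exp.comp (Complex.continuous_ofReal.comp (by fun_prop)).neg)
  intro X hX
  exact closure_minimal (s := (G : Set (Lp ℝ 2 P))) hG hc hX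

variable {G : Submodule ℝ (Lp ℝ 2 P)}

lemma IsGaussianSubspace.charFun_map (hG : IsGaussianSubspace G) {X : Lp ℝ 2 P} (hX : X ∈ G)
    (t : ℝ) : charFun (P.map X) t = Complex.exp (-(t ^ 2 * ‖X‖ ^ 2 / 2 : ℝ)) := by
  rw [charFun_apply_real, integral_map (Lp.aestronglyMeasurable X).aemeasurable
    (by fun_prop)]
  have h := hG (t • X) (G.smul_mem t hX)
  rw [norm_smul, mul_pow, Real.norm_eq_abs, sq_abs] at h
  rw [← h]
  refine integral_congr_ae ?_
  filter_upwards [Lp.coeFn_smul t X] with ω hω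
  rw [hω, Pi.smul_apply, smul_eq_mul]
  push_cast
  ring_nf

lemma IsGaussianSubspace.map_eq_gaussianReal [IsProbabilityMeasure P]
    (hG : IsGaussianSubspace G) {X : Lp ℝ 2 P} (hX : X ∈ G) :
    P.map X = gaussianReal 0 (‖X‖₊ ^ 2) := by
  have := Measure.isProbabilityMeasure_map (μ := P) (Lp.aestronglyMeasurable X).aemeasurable
  refine Measure.ext_of_charFun (funext fun t => ?_)
  rw [hG.charFun_map hX, charFun_gaussianReal]
  push_cast
  congr 1
  ring

lemma norm_sq_sum_smul_of_orthogonal {E ι : Type*} [NormedAddCommGroup E] [InnerProductSpace ℝ E]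
    [Fintype ι] {Z : ι → E} (ho : Pairwise fun i j => inner ℝ (Z i) (Z j) = 0) (c : ι → ℝ) :
    ‖∑ i, c i • Z i‖ ^ 2 = ∑ i, c i ^ 2 * ‖Z i‖ ^ 2 := by
  classical
  rw [← real_inner_self_eq_norm_sq, sum_inner]
  refine Finset.sum_congr rfl fun i _ => ?_
  rw [inner_sum, Finset.sum_eq_single i]
  · rw [real_inner_smul_left, real_inner_smul_right, real_inner_self_eq_norm_sq]; ring
  · intro j _ hj
    rw [real_inner_smul_left, real_inner_smul_right, ho hj.symm]; ring
  · simp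

/-- Orthogonal elements of a Gaussian subspace are independent. -/
lemma IsGaussianSubspace.iIndepFun_of_orthogonal [IsProbabilityMeasure P]
    (hG : IsGaussianSubspace G) {ι : Type*} [Fintype ι] {Z : ι → Lp ℝ 2 P} (hZ : ∀ i, Z i ∈ G)
    (ho : Pairwise fun i j => inner ℝ (Z i) (Z j) = 0) :
    iIndepFun (fun i => (Z i : Ω → ℝ)) P := by
  have hm : ∀ i, AEMeasurable (Z i : Ω → ℝ) P := fun i => (Lp.aestronglyMeasurable _).aemeasurable
  refine (iIndepFun_iff_charFun_pi hm).2 fun t => ?_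
  simp_rw [hG.charFun_map (hZ _), ← Complex.exp_sum]
  have hmem : ∑ i, t i • Z i ∈ G := G.sum_mem fun i _ => G.smul_mem _ (hZ i)
  have h := hG _ hmem
  rw [norm_sq_sum_smul_of_orthogonal ho] at h
  rw [charFun_apply, integral_map (by fun_prop) (by fun_prop)]
  have h1 : (∑ x, -(((t x ^ 2 * ‖Z x‖ ^ 2 / 2 : ℝ)) : ℂ)) =
      -(((∑ i, t i ^ 2 * ‖Z i‖ ^ 2) / 2 : ℝ) : ℂ) := by
    rw [Finset.sum_neg_distrib, Finset.sum_div]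
    push_cast
    rfl
  rw [h1, ← h]
  refine integral_congr_ae ?_
  have hs : ∀ᵐ ω ∂P, (∑ i, t i • Z i : Lp ℝ 2 P) ω = ∑ i, t i * Z i ω := by
    filter_upwards [Lp.coeFn_finsetSum (s := Finset.univ) (f := fun i => t i • Z i),
      ae_all_iff.2 fun i => Lp.coeFn_smul (t i) (Z i)] with ω h1 h2
    rw [h1, Finset.sum_apply]
    exact Finset.sum_congr rfl fun i _ => by rw [h2]; rfl
  filter_upwards [hs] with ω hω
  rw [hω, PiLp.inner_apply, mul_comm]
  simp [mul_comm]

end GaussianSubspace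

/-! ### Quadratic functionals of Gaussian families -/

section ChiSquare

lemma integral_exp_mul_sq_gaussianReal (w : ℝ≥0) {t : ℝ} (ht : 2 * (t * w) < 1) :
    ∫ x, Real.exp (t * x ^ 2) ∂gaussianReal 0 w = (√(1 - 2 * (t * w)))⁻¹ := by
  rcases eq_or_ne w 0 with rfl | hw
  · simp
  · have hw' : (0 : ℝ) < w := by positivity
    rw [integral_gaussianReal_eq_integral_smul hw]
    have h1 : ∀ x : ℝ, gaussianPDFReal 0 w x • Real.exp (t * x ^ 2) =
        (√(2 * Real.pi * w))⁻¹ * Real.exp (-((1 - 2 * (t * w)) / (2 * w)) * x ^ 2) := by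
      intro x
      rw [gaussianPDFReal_def, smul_eq_mul, mul_assoc, ← Real.exp_add]
      congr 2
      field_simp
      ring
    simp_rw [h1]
    rw [integral_const_mul, integral_gaussian, ← Real.sqrt_inv, ← Real.sqrt_inv,
      ← Real.sqrt_mul (by positivity)]
    congr 1
    have : 1 - 2 * (t * w) ≠ 0 := by linarith
    field_simp

variable {Ω : Type*} [MeasurableSpace Ω] {P : Measure Ω}

lemma mgf_sq_of_map_eq_gaussianReal {X : Ω → ℝ} (hX : AEMeasurable X P) {w : ℝ≥0}
    (h : P.map X = gaussianReal 0 w) {t : ℝ} (ht : 2 * (t * w) < 1) :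
    mgf (fun ω => X ω ^ 2) P t = (√(1 - 2 * (t * w)))⁻¹ := by
  rw [← integral_exp_mul_sq_gaussianReal w ht, ← h,
    integral_map hX (Measurable.aestronglyMeasurable (by fun_prop)), mgf]

/-- Third-order expansion of the cumulant generating function of the `χ²` law. -/
lemma abs_neg_half_log_sub_le {x : ℝ} (hx : |x| ≤ 1 / 4) :
    |-(1 / 2) * Real.log (1 - 2 * x) - x - x ^ 2| ≤ 8 * |x| ^ 3 := by
  have h2 : |2 * x| ≤ 1 / 2 := by rw [abs_mul, abs_two]; linarith
  have h := Real.abs_log_sub_add_sum_range_le (x := 2 * x) (by linarith) 2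
  simp only [Finset.sum_range_succ, Finset.sum_range_zero] at h
  norm_num at h
  have e : -(1 / 2) * Real.log (1 - 2 * x) - x - x ^ 2 =
      -(1 / 2) * (2 * x + (2 * x) ^ 2 / 2 + Real.log (1 - 2 * x)) := by ring
  rw [e, abs_mul]
  have h3 : (2 * |x|) ^ 3 / (1 - 2 * |x|) ≤ 16 * |x| ^ 3 := by
    rw [div_le_iff₀ (by linarith)]
    nlinarith [pow_nonneg (abs_nonneg x) 3]
  have h4 : |-(1 / 2 : ℝ)| = 1 / 2 := by norm_num
  rw [h4]
  linarith

variable {G : Submodule ℝ (Lp ℝ 2 P)} {ι : Type*} [Fintype ι]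

/-- The cumulant generating function of a centered quadratic functional of independent centered
Gaussian variables agrees with that of a Gaussian of variance `2 ∑ (aᵢ‖Zᵢ‖²)²`, up to a cubic
error. -/
lemma IsGaussianSubspace.abs_cgf_quadratic_sub_le [IsProbabilityMeasure P]
    (hG : IsGaussianSubspace G)
    {Z : ι → Lp ℝ 2 P} (hZ : ∀ i, Z i ∈ G)
    (ho : Pairwise fun i j => inner ℝ (Z i) (Z j) = 0) (a : ι → ℝ) {t : ℝ}
    (ht : ∀ i, |t * (a i * ‖Z i‖ ^ 2)| ≤ 1 / 4) :
    Integrable (fun ω => Real.exp (t * ((∑ i, a i * Z i ω ^ 2) - ∑ i, a i * ‖Z i‖ ^ 2))) P ∧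
    |cgf (fun ω => (∑ i, a i * Z i ω ^ 2) - ∑ i, a i * ‖Z i‖ ^ 2) P t -
      t ^ 2 * ∑ i, (a i * ‖Z i‖ ^ 2) ^ 2| ≤
      8 * |t| ^ 3 * ∑ i, |a i * ‖Z i‖ ^ 2| ^ 3 := by
  set Y : ι → Ω → ℝ := fun i ω => a i * Z i ω ^ 2 with hY
  have hmeas : ∀ i, Measurable (Y i) := fun i =>
    ((Lp.stronglyMeasurable (Z i)).measurable.pow_const 2).const_mul _
  have hind : iIndepFun Y P :=
    (hG.iIndepFun_of_orthogonal hZ ho).comp (fun i x => a i * x ^ 2) fun i => by fun_prop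
  have hlt : ∀ i, 2 * (t * (a i * ‖Z i‖ ^ 2)) < 1 := fun i => by
    have := (abs_le.1 (ht i)).2
    linarith
  have hmgf : ∀ i, mgf (Y i) P t = (√(1 - 2 * (t * (a i * ‖Z i‖ ^ 2))))⁻¹ := by
    intro i
    have := mgf_sq_of_map_eq_gaussianReal (t := a i * t)
      (Lp.aestronglyMeasurable (Z i)).aemeasurable (hG.map_eq_gaussianReal (hZ i))
      (by simpa [mul_assoc, mul_left_comm] using hlt i)
    rw [hY, mgf_const_mul, this]
    congr 3
    push_cast
    ring
  have hpos : ∀ i, 0 < mgf (Y i) P t := fun i => by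
    rw [hmgf]
    exact inv_pos.2 (Real.sqrt_pos.2 (by linarith [hlt i]))
  -- the moment generating function would be `0` if the exponential were not integrable
  have hint : ∀ i ∈ Finset.univ, Integrable (fun ω => Real.exp (t * Y i ω)) P := by
    intro i _
    by_contra hn
    exact (hpos i).ne' (mgf_undef hn)
  have hsum := hind.integrable_exp_mul_sum hmeas hint
  have hcgf := hind.cgf_sum₀ (fun i => (hmeas i).aemeasurable) hint
  have hcgf' : ∀ i, cgf (Y i) P t = -(1 / 2) * Real.log (1 - 2 * (t * (a i * ‖Z i‖ ^ 2))) := by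
    intro i
    rw [cgf, hmgf, Real.log_inv, Real.log_sqrt (by linarith [hlt i])]
    ring
  have hfun : (∑ i, Y i) = fun ω => ∑ i, a i * Z i ω ^ 2 := by
    ext ω
    simp [hY, Finset.sum_apply]
  set m := ∑ i, a i * ‖Z i‖ ^ 2 with hm
  have hi : Integrable (fun ω => Real.exp (t * ((∑ i, a i * Z i ω ^ 2) - m))) P := by
    rw [hfun] at hsum
    refine (hsum.mul_const (Real.exp (-(t * m)))).congr (ae_of_all _ fun ω => ?_)
    simp only
    rw [← Real.exp_add]
    ring_nf
  refine ⟨hi, ?_⟩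
  have hc : cgf (fun ω => (∑ i, a i * Z i ω ^ 2) - m) P t =
      ∑ i, (-(1 / 2) * Real.log (1 - 2 * (t * (a i * ‖Z i‖ ^ 2))) - t * (a i * ‖Z i‖ ^ 2)) := by
    have h1 : cgf (fun ω => (∑ i, a i * Z i ω ^ 2) - m) P t = cgf (∑ i, Y i) P t - t * m := by
      simp_rw [sub_eq_add_neg (∑ i, a i * Z i _ ^ 2) m]
      rw [cgf, mgf_add_const, Real.log_mul, Real.log_exp, hfun, cgf]
      · ring
      · rw [← hfun]
        exact (mgf_pos hsum).ne'
      · exact (Real.exp_pos _).ne'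
    rw [h1, hcgf, Finset.sum_sub_distrib, hm, Finset.mul_sum]
    simp_rw [hcgf']
  rw [hc, Finset.mul_sum, ← Finset.sum_sub_distrib, Finset.mul_sum]
  refine (Finset.abs_sum_le_sum_abs _ _).trans (Finset.sum_le_sum fun i _ => ?_)
  refine le_trans (le_of_eq ?_) ((abs_neg_half_log_sub_le (ht i)).trans (le_of_eq ?_))
  · congr 1; ring
  · rw [abs_mul, mul_pow]; ring

end ChiSquare

/-! ### Moderate deviations of triangular arrays -/

section Triangular

variable {Ω : Type*} [MeasurableSpace Ω] {P : Measure Ω} [IsProbabilityMeasure P]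
  {G : Submodule ℝ (Lp ℝ 2 P)}

/-- Moderate deviations for triangular arrays of Gaussian quadratic functionals whose coefficients
are of order `1 / n`. -/
lemma IsGaussianSubspace.hasQuadraticCGFLimit (hG : IsGaussianSubspace G)
    {ι : ℕ → Type*} [∀ n, Fintype (ι n)] {Z : ∀ n, ι n → Lp ℝ 2 P} (hZ : ∀ n i, Z n i ∈ G)
    {a : ∀ n, ι n → ℝ} {b : ℕ → ℝ} {C v : ℝ}
    (hb : Tendsto b atTop atTop) (hbn : Tendsto (fun n : ℕ => b n / √n) atTop (𝓝 0))
    (hcard : ∀ n, Fintype.card (ι n) ≤ 2 * n)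
    (ho : ∀ n, 1 ≤ n → Pairwise fun i j => inner ℝ (Z n i) (Z n j) = 0)
    (hC : ∀ n, 1 ≤ n → ∀ i, |a n i * ‖Z n i‖ ^ 2| ≤ C / n)
    (hv : Tendsto (fun n : ℕ => n * ∑ i, (a n i * ‖Z n i‖ ^ 2) ^ 2) atTop (𝓝 (v / 2))) :
    HasQuadraticCGFLimit P (fun n ω => √n / b n *
      ((∑ i, a n i * Z n i ω ^ 2) - ∑ i, a n i * ‖Z n i‖ ^ 2)) (fun n => b n ^ 2) v := by
  intro l
  have hC0 : 0 ≤ |C| := abs_nonneg C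
  have hsmall : ∀ᶠ n : ℕ in atTop, |l| * |C| * (b n / √n) ≤ 1 / 4 := by
    have : Tendsto (fun n : ℕ => |l| * |C| * (b n / √n)) atTop (𝓝 0) := by
      simpa using hbn.const_mul (|l| * |C|)
    exact this.eventually_le_const (by norm_num)
  have key : ∀ᶠ n : ℕ in atTop,
      Integrable (fun ω => Real.exp (b n ^ 2 * l * (√n / b n *
        ((∑ i, a n i * Z n i ω ^ 2) - ∑ i, a n i * ‖Z n i‖ ^ 2)))) P ∧
      |(b n ^ 2)⁻¹ * cgf (fun ω => √n / b n *
        ((∑ i, a n i * Z n i ω ^ 2) - ∑ i, a n i * ‖Z n i‖ ^ 2)) P (b n ^ 2 * l) -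
        l ^ 2 * (n * ∑ i, (a n i * ‖Z n i‖ ^ 2) ^ 2)| ≤ 16 * |l| ^ 3 * |C| ^ 3 * (b n / √n) := by
    filter_upwards [hsmall, hb.eventually_gt_atTop 0, eventually_ge_atTop 1] with n h1 h2 h3
    have hn : (0 : ℝ) < n := by exact_mod_cast h3
    have hs : 0 < √(n : ℝ) := Real.sqrt_pos.2 hn
    have hss : √(n : ℝ) ^ 2 = n := Real.sq_sqrt hn.le
    have hC' : ∀ i, |a n i * ‖Z n i‖ ^ 2| ≤ |C| / n := fun i =>
      (hC n h3 i).trans (by gcongr; exact le_abs_self C)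
    have hmul : √(n : ℝ) / b n * (b n ^ 2 * l) = b n * √n * l := by field_simp
    have ht : ∀ i, |(b n * √n * l) * (a n i * ‖Z n i‖ ^ 2)| ≤ 1 / 4 := by
      intro i
      refine le_trans ?_ h1
      rw [abs_mul, abs_mul, abs_of_pos (mul_pos h2 hs)]
      calc b n * √n * |l| * |a n i * ‖Z n i‖ ^ 2| ≤ b n * √n * |l| * (|C| / n) := by
            gcongr; exact hC' i
        _ = |l| * |C| * (b n / √n) := by
            have E : ∀ s x : ℝ, 0 < s → x = s ^ 2 →
                b n * s * |l| * (|C| / x) = |l| * |C| * (b n / s) := by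
              rintro s _ hs rfl; field_simp
            exact E _ _ hs hss.symm
    obtain ⟨i1, i2⟩ := hG.abs_cgf_quadratic_sub_le (hZ n) (ho n h3) (a n) ht
    refine ⟨?_, ?_⟩
    · convert i1 using 3 with ω
      rw [← hmul]; ring
    · have hcgf : cgf (fun ω => √n / b n *
        ((∑ i, a n i * Z n i ω ^ 2) - ∑ i, a n i * ‖Z n i‖ ^ 2)) P (b n ^ 2 * l) =
          cgf (fun ω => (∑ i, a n i * Z n i ω ^ 2) - ∑ i, a n i * ‖Z n i‖ ^ 2) P
            (b n * √n * l) := by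
        rw [cgf, mgf_const_mul, hmul, cgf]
      rw [hcgf]
      set c := cgf (fun ω => (∑ i, a n i * Z n i ω ^ 2) - ∑ i, a n i * ‖Z n i‖ ^ 2) P
            (b n * √n * l)
      have e1 : (b n ^ 2)⁻¹ * c - l ^ 2 * (n * ∑ i, (a n i * ‖Z n i‖ ^ 2) ^ 2) =
          (b n ^ 2)⁻¹ * (c - (b n * √n * l) ^ 2 * ∑ i, (a n i * ‖Z n i‖ ^ 2) ^ 2) := by
        rw [mul_pow, mul_pow, hss]
        field_simp
      rw [e1, abs_mul, abs_of_pos (by positivity : 0 < (b n ^ 2)⁻¹), inv_mul_le_iff₀ (by positivity)]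
      refine i2.trans ?_
      have hsum : ∑ i, |a n i * ‖Z n i‖ ^ 2| ^ 3 ≤ 2 * n * (|C| / n) ^ 3 := by
        calc ∑ i, |a n i * ‖Z n i‖ ^ 2| ^ 3 ≤ ∑ _i : ι n, (|C| / n) ^ 3 := by
              refine Finset.sum_le_sum fun i _ => ?_
              gcongr
              exact hC' i
          _ = Fintype.card (ι n) * (|C| / n) ^ 3 := by
              rw [Finset.sum_const, Finset.card_univ, nsmul_eq_mul]
          _ ≤ 2 * n * (|C| / n) ^ 3 := by
              gcongr
              exact_mod_cast hcard n
      rw [abs_mul, abs_of_pos (mul_pos h2 hs)]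
      calc 8 * (b n * √n * |l|) ^ 3 * ∑ i, |a n i * ‖Z n i‖ ^ 2| ^ 3
          ≤ 8 * (b n * √n * |l|) ^ 3 * (2 * n * (|C| / n) ^ 3) := by gcongr
        _ = b n ^ 2 * (16 * |l| ^ 3 * |C| ^ 3 * (b n / √n)) := by
            have E : ∀ s x : ℝ, 0 < s → x = s ^ 2 → 8 * (b n * s * |l|) ^ 3 *
                (2 * x * (|C| / x) ^ 3) = b n ^ 2 * (16 * |l| ^ 3 * |C| ^ 3 * (b n / s)) := by
              rintro s _ hs rfl; field_simp; ring
            exact E _ _ hs hss.symm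
  refine ⟨key.mono fun n h => h.1, ?_⟩
  have hlim : Tendsto (fun n : ℕ => l ^ 2 * (n * ∑ i, (a n i * ‖Z n i‖ ^ 2) ^ 2)) atTop
      (𝓝 (v * l ^ 2 / 2)) := by
    convert hv.const_mul (l ^ 2) using 2
    ring
  have herr : Tendsto (fun n : ℕ => 16 * |l| ^ 3 * |C| ^ 3 * (b n / √n)) atTop (𝓝 0) := by
    simpa using hbn.const_mul (16 * |l| ^ 3 * |C| ^ 3)
  have h0 := squeeze_zero_norm' (key.mono fun n h => (Real.norm_eq_abs _).trans_le h.2) herr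
  simpa using h0.add hlim

end Triangular

/-! ### The Gaussian space of a Brownian motion -/

section BrownianSpan

variable {Ω : Type*} [MeasurableSpace Ω] {P : Measure Ω} {B B' : ℝ≥0 → Ω → ℝ}

lemma ProbabilityTheory.IsPreBrownianReal.memLp_two (hB : IsPreBrownianReal B P) (t : ℝ≥0) :
    MemLp (B t) 2 P :=
  (hB.isGaussianProcess.hasGaussianLaw_eval t).memLp_two

/-- The value at time `t` of a Brownian motion, as an element of `L²(P)`. -/
noncomputable def brownianLp (hB : IsPreBrownianReal B P) (t : ℝ≥0) : Lp ℝ 2 P :=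
  (hB.memLp_two t).toLp (B t)

/-- The span in `L²(P)` of the values of a Brownian motion. -/
noncomputable def brownianSpan (hB : IsPreBrownianReal B P) : Submodule ℝ (Lp ℝ 2 P) :=
  Submodule.span ℝ (range (brownianLp hB))

lemma coeFn_brownianLp (hB : IsPreBrownianReal B P) (t : ℝ≥0) : brownianLp hB t =ᵐ[P] B t :=
  MemLp.coeFn_toLp _

lemma brownianLp_mem_span (hB : IsPreBrownianReal B P) (t : ℝ≥0) :
    brownianLp hB t ∈ brownianSpan hB :=
  Submodule.subset_span (mem_range_self t)

lemma exists_ae_eq_sum_of_mem_brownianSpan (hB : IsPreBrownianReal B P) {X : Lp ℝ 2 P}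
    (hX : X ∈ brownianSpan hB) :
    ∃ (I : Finset ℝ≥0) (c : ℝ≥0 → ℝ), X =ᵐ[P] fun ω => ∑ t ∈ I, c t * B t ω := by
  obtain ⟨c, rfl⟩ := Finsupp.mem_span_range_iff_exists_finsupp.1 hX
  refine ⟨c.support, c, ?_⟩
  have h : ∀ t ∈ c.support, ((c t • brownianLp hB t : Lp ℝ 2 P) : Ω → ℝ) =ᵐ[P]
      fun ω => c t * B t ω := by
    intro t _
    filter_upwards [Lp.coeFn_smul (c t) (brownianLp hB t), coeFn_brownianLp hB t] with ω h1 h2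
    rw [h1, Pi.smul_apply, h2, smul_eq_mul]
  filter_upwards [Lp.coeFn_finsetSum (s := c.support) (f := fun t => c t • brownianLp hB t),
    (eventually_all_finset c.support).2 h] with ω h1 h2
  rw [Finsupp.sum, h1, Finset.sum_apply]
  exact Finset.sum_congr rfl h2

lemma Lp_two_norm_sq_eq_integral (X : Lp ℝ 2 P) : ‖X‖ ^ 2 = ∫ ω, X ω ^ 2 ∂P := by
  rw [← real_inner_self_eq_norm_sq, L2.inner_def]
  simp [sq]

lemma isGaussianSubspace_brownianSpan (hB : IsPreBrownianReal B P) :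
    IsGaussianSubspace (brownianSpan hB) := by
  intro X hX
  have := hB.isGaussianProcess.isProbabilityMeasure
  obtain ⟨I, c, hc⟩ := exists_ae_eq_sum_of_mem_brownianSpan hB hX
  have hg : HasGaussianLaw (fun ω => ∑ t ∈ I, c t * B t ω) P := by
    simpa using (hB.isGaussianProcess.smul c).hasGaussianLaw_fun_sum (I := I)
  have h0 : P[fun ω => ∑ t ∈ I, c t * B t ω] = 0 := by
    rw [integral_finsetSum _ fun t _ => (hB.integrable_eval t).const_mul _]
    refine Finset.sum_eq_zero fun t _ => ?_
    rw [integral_const_mul, hB.integral_eval, mul_zero]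
  have hm := hg.map_eq_gaussianReal
  have hvar : Var[fun ω => ∑ t ∈ I, c t * B t ω; P] = ‖X‖ ^ 2 := by
    rw [variance_of_integral_eq_zero hg.aemeasurable h0, Lp_two_norm_sq_eq_integral]
    refine integral_congr_ae ?_
    filter_upwards [hc] with ω hω
    rw [hω]
  have h1 := charFun_gaussianReal (μ := 0) (v := Var[fun ω => ∑ t ∈ I, c t * B t ω; P].toNNReal) 1
  rw [h0] at hm
  rw [← hm, charFun_apply_real, integral_map hg.aemeasurable (by fun_prop),
    Real.coe_toNNReal _ (variance_nonneg _ _), hvar] at h1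
  have h2 : ∫ ω, Complex.exp (Complex.I * (X ω : ℂ)) ∂P =
      ∫ ω, Complex.exp (((1 : ℝ) : ℂ) * ((∑ t ∈ I, c t * B t ω : ℝ) : ℂ) * Complex.I) ∂P := by
    refine integral_congr_ae ?_
    filter_upwards [hc] with ω hω
    rw [hω, Complex.ofReal_one, one_mul, mul_comm]
  rw [h2, h1]
  congr 1
  push_cast
  ring

lemma IsGaussianSubspace.integral_eq_zero [IsProbabilityMeasure P]
    {G : Submodule ℝ (Lp ℝ 2 P)} (hG : IsGaussianSubspace G)
    {X : Lp ℝ 2 P} (hX : X ∈ G) : ∫ ω, X ω ∂P = 0 := by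
  have h : ∫ x, x ∂(P.map X) = 0 := by
    rw [hG.map_eq_gaussianReal hX]
    exact integral_id_gaussianReal
  rwa [integral_map (Lp.aestronglyMeasurable X).aemeasurable (by fun_prop)] at h

lemma IsGaussianSubspace.inner_eq_zero_of_indepFun [IsProbabilityMeasure P]
    {G : Submodule ℝ (Lp ℝ 2 P)}
    (hG : IsGaussianSubspace G) {X Y : Lp ℝ 2 P} (hX : X ∈ G)
    (h : IndepFun (X : Ω → ℝ) (Y : Ω → ℝ) P) : inner ℝ X Y = 0 := by
  rw [L2.inner_def]
  have := h.integral_fun_mul_eq_mul_integral (Lp.aestronglyMeasurable X)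
    (Lp.aestronglyMeasurable Y)
  rw [hG.integral_eq_zero hX, zero_mul] at this
  rw [← this]
  refine integral_congr_ae (ae_of_all _ fun ω => ?_)
  simp [mul_comm]

/-- Independent Gaussian subspaces are jointly Gaussian. -/
lemma IsGaussianSubspace.sup [IsProbabilityMeasure P] {G G' : Submodule ℝ (Lp ℝ 2 P)}
    (hG : IsGaussianSubspace G) (hG' : IsGaussianSubspace G')
    (h : ∀ X ∈ G, ∀ Y ∈ G', IndepFun (X : Ω → ℝ) (Y : Ω → ℝ) P) :
    IsGaussianSubspace (G ⊔ G') := by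
  intro Z hZ
  obtain ⟨X, hX, Y, hY, rfl⟩ := Submodule.mem_sup.1 hZ
  have hXY := h X hX Y hY
  have e : ∫ ω, Complex.exp (Complex.I * ((X + Y : Lp ℝ 2 P) ω : ℂ)) ∂P =
      ∫ ω, Complex.exp (Complex.I * (X ω : ℂ)) * Complex.exp (Complex.I * (Y ω : ℂ)) ∂P := by
    refine integral_congr_ae ?_
    filter_upwards [Lp.coeFn_add X Y] with ω hω
    rw [hω, Pi.add_apply, ← Complex.exp_add]
    push_cast
    ring_nf
  have hn : ‖X + Y‖ ^ 2 = ‖X‖ ^ 2 + ‖Y‖ ^ 2 := by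
    rw [norm_add_sq_real, hG.inner_eq_zero_of_indepFun hX hXY]
    ring
  have hc : Measurable fun x : ℝ => Complex.exp (Complex.I * (x : ℂ)) := by fun_prop
  have hi := (hXY.comp hc hc).integral_fun_mul_eq_mul_integral
    (integrable_cexp_I_mul (Lp.aestronglyMeasurable X)).aestronglyMeasurable
    (integrable_cexp_I_mul (Lp.aestronglyMeasurable Y)).aestronglyMeasurable
  simp only [Function.comp_apply] at hi
  rw [e, hi, hG X hX, hG' Y hY, hn, ← Complex.exp_add]
  congr 1
  push_cast
  ring

lemma indepFun_of_mem_brownianSpan (hB : IsPreBrownianReal B P) (hB' : IsPreBrownianReal B' P)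
    (h : IndepFun (fun ω t => B t ω) (fun ω t => B' t ω) P) {X Y : Lp ℝ 2 P}
    (hX : X ∈ brownianSpan hB) (hY : Y ∈ brownianSpan hB') :
    IndepFun (X : Ω → ℝ) (Y : Ω → ℝ) P := by
  obtain ⟨I, c, hc⟩ := exists_ae_eq_sum_of_mem_brownianSpan hB hX
  obtain ⟨I', c', hc'⟩ := exists_ae_eq_sum_of_mem_brownianSpan hB' hY
  refine IndepFun.congr ?_ hc.symm hc'.symm
  exact h.comp (φ := fun x : ℝ≥0 → ℝ => ∑ t ∈ I, c t * x t)
    (ψ := fun x : ℝ≥0 → ℝ => ∑ t ∈ I', c' t * x t) (by fun_prop) (by fun_prop)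

lemma inner_brownianLp (hB : IsPreBrownianReal B P) (s t : ℝ≥0) :
    inner ℝ (brownianLp hB s) (brownianLp hB t) = ((min s t : ℝ≥0) : ℝ) := by
  have := hB.isGaussianProcess.isProbabilityMeasure
  have h := hB.covariance_eval s t
  rw [covariance_eq_sub (hB.memLp_two s) (hB.memLp_two t), hB.integral_eval, zero_mul,
    sub_zero] at h
  rw [← h, L2.inner_def]
  refine integral_congr_ae ?_
  filter_upwards [coeFn_brownianLp hB s, coeFn_brownianLp hB t] with ω h1 h2
  simp [h1, h2, mul_comm]

/-- Orthogonality to a subspace extends to its closure. -/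
lemma inner_eq_zero_of_mem_closure {E : Type*} [NormedAddCommGroup E] [InnerProductSpace ℝ E]
    {G G' : Submodule ℝ E} (h : ∀ x ∈ G, ∀ y ∈ G', inner ℝ x y = 0) {x y : E}
    (hx : x ∈ G) (hy : y ∈ G'.topologicalClosure) : inner ℝ x y = 0 := by
  have hc : IsClosed {y : E | inner ℝ x y = 0} := isClosed_eq (by fun_prop) continuous_const
  exact closure_minimal (s := (G' : Set E)) (fun y hy => h x hx y hy) hc hy

end BrownianSpan

/-! ### Wiener integrals -/

section Wiener

variable {Ω : Type*} [MeasurableSpace Ω] {P : Measure Ω} {B B' : ℝ≥0 → Ω → ℝ}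

/-- The class in `L²(P)` of the integral of a step function. -/
noncomputable def stepIntegralLp (hB : IsPreBrownianReal B P) (N : ℕ) (τ : ℕ → ℝ≥0) (c : ℕ → ℝ)
    (t : ℝ≥0) : Lp ℝ 2 P :=
  ∑ i ∈ Finset.range N, c i • (brownianLp hB (min (τ (i + 1)) t) - brownianLp hB (min (τ i) t))

lemma coeFn_stepIntegralLp (hB : IsPreBrownianReal B P) (N : ℕ) (τ : ℕ → ℝ≥0) (c : ℕ → ℝ)
    (t : ℝ≥0) : stepIntegralLp hB N τ c t =ᵐ[P] stepIntegral B N τ c t := by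
  have h : ∀ i ∈ Finset.range N, ((c i • (brownianLp hB (min (τ (i + 1)) t) -
      brownianLp hB (min (τ i) t)) : Lp ℝ 2 P) : Ω → ℝ) =ᵐ[P]
      fun ω => c i * (B (min (τ (i + 1)) t) ω - B (min (τ i) t) ω) := by
    intro i _
    filter_upwards [Lp.coeFn_smul (c i) (brownianLp hB (min (τ (i + 1)) t) -
      brownianLp hB (min (τ i) t)), Lp.coeFn_sub (brownianLp hB (min (τ (i + 1)) t))
      (brownianLp hB (min (τ i) t)), coeFn_brownianLp hB (min (τ (i + 1)) t),
      coeFn_brownianLp hB (min (τ i) t)] with ω h1 h2 h3 h4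
    rw [h1, Pi.smul_apply, h2, Pi.sub_apply, h3, h4, smul_eq_mul]
  filter_upwards [Lp.coeFn_finsetSum (s := Finset.range N) (f := fun i =>
    c i • (brownianLp hB (min (τ (i + 1)) t) - brownianLp hB (min (τ i) t))),
    (eventually_all_finset (Finset.range N)).2 h] with ω h1 h2
  rw [stepIntegralLp, h1, Finset.sum_apply, stepIntegral]
  exact Finset.sum_congr rfl h2

lemma stepIntegralLp_mem_span (hB : IsPreBrownianReal B P) (N : ℕ) (τ : ℕ → ℝ≥0) (c : ℕ → ℝ)
    (t : ℝ≥0) : stepIntegralLp hB N τ c t ∈ brownianSpan hB :=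
  Submodule.sum_mem _ fun _ _ => Submodule.smul_mem _ _
    (Submodule.sub_mem _ (brownianLp_mem_span hB _) (brownianLp_mem_span hB _))

lemma IsWienerIntegral.exists_tendsto (hB : IsPreBrownianReal B P) {f : ℝ → ℝ} {t : ℝ≥0}
    {J : Ω → ℝ} (h : IsWienerIntegral P B f t J) :
    ∃ (N : ℕ → ℕ) (τ : ℕ → ℕ → ℝ≥0) (c : ℕ → ℕ → ℝ), (∀ m, Monotone (τ m)) ∧
      Tendsto (fun m => eLpNorm (fun s => f s - stepFunction (N m) (τ m) (c m) s) 2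
        (volume.restrict (Ioc (0 : ℝ) t))) atTop (𝓝 0) ∧
      Tendsto (fun m => stepIntegralLp hB (N m) (τ m) (c m) t) atTop (𝓝 (h.2.1.toLp J)) := by
  obtain ⟨N, τ, c, h1, h2, h3⟩ := h.2.2
  refine ⟨N, τ, c, h1, h2, ?_⟩
  rw [Lp.tendsto_Lp_iff_tendsto_eLpNorm']
  refine h3.congr fun m => ?_
  rw [eLpNorm_sub_comm]
  refine eLpNorm_congr_ae ?_
  filter_upwards [coeFn_stepIntegralLp hB (N m) (τ m) (c m) t, h.2.1.coeFn_toLp] with ω h4 h5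
  rw [Pi.sub_apply, h4, h5]

lemma IsWienerIntegral.toLp_mem_closure (hB : IsPreBrownianReal B P) {f : ℝ → ℝ} {t : ℝ≥0}
    {J : Ω → ℝ} (h : IsWienerIntegral P B f t J) :
    h.2.1.toLp J ∈ (brownianSpan hB).topologicalClosure := by
  obtain ⟨N, τ, c, -, -, h3⟩ := h.exists_tendsto hB
  exact mem_closure_of_tendsto h3
    (Eventually.of_forall fun m => stepIntegralLp_mem_span hB (N m) (τ m) (c m) t)

lemma integrable_indicator_Ioc (a b c : ℝ) :
    Integrable ((Ioc a b).indicator fun _ => c) (volume : Measure ℝ) :=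
  (integrable_indicator_iff measurableSet_Ioc).2
    (integrableOn_const (by simp [Real.volume_Ioc]))

lemma integrable_stepFunction (N : ℕ) (τ : ℕ → ℝ≥0) (c : ℕ → ℝ) :
    Integrable (stepFunction N τ c) := by
  unfold stepFunction
  exact integrable_finsetSum _ fun i _ => integrable_indicator_Ioc _ _ _

lemma inner_brownianLp_stepIntegralLp (hB : IsPreBrownianReal B P) (N : ℕ) {τ : ℕ → ℝ≥0}
    (hτ : Monotone τ) (c : ℕ → ℝ) (s t : ℝ≥0) :
    inner ℝ (brownianLp hB s) (stepIntegralLp hB N τ c t) =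
      ∫ x in Ioc (0 : ℝ) (min s t : ℝ≥0), stepFunction N τ c x := by
  unfold stepFunction
  rw [integral_finsetSum _ fun i _ => (integrable_indicator_Ioc _ _ _).integrableOn,
    stepIntegralLp, inner_sum]
  refine Finset.sum_congr rfl fun i _ => ?_
  rw [inner_smul_right, inner_sub_right, inner_brownianLp, inner_brownianLp,
    setIntegral_indicator measurableSet_Ioc, setIntegral_const, Ioc_inter_Ioc, measureReal_def,
    Real.volume_Ioc, smul_eq_mul, mul_comm]
  congr 1
  have h1 : (τ i : ℝ) ≤ τ (i + 1) := by exact_mod_cast hτ (Nat.le_succ i)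
  have h2 : (0 : ℝ) ≤ τ i := (τ i).2
  rw [ENNReal.toReal_ofReal']
  push_cast
  rw [max_eq_right h2]
  simp only [min_def, max_def]
  split_ifs <;> linarith

/-- The covariance of a Wiener integral with the values of the Brownian motion. Together with
`IsWienerIntegral.toLp_mem_closure` it determines the Wiener integral almost surely. -/
lemma IsWienerIntegral.inner_brownianLp (hB : IsPreBrownianReal B P) {f : ℝ → ℝ} {t : ℝ≥0}
    {J : Ω → ℝ} (h : IsWienerIntegral P B f t J) (s : ℝ≥0) :
    inner ℝ (brownianLp hB s) (h.2.1.toLp J) = ∫ x in Ioc (0 : ℝ) (min s t : ℝ≥0), f x := by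
  obtain ⟨N, τ, c, h1, h2, h3⟩ := h.exists_tendsto hB
  have l1 : Tendsto (fun m => inner ℝ (brownianLp hB s)
      (stepIntegralLp hB (N m) (τ m) (c m) t)) atTop
      (𝓝 (inner ℝ (brownianLp hB s) (h.2.1.toLp J))) := tendsto_const_nhds.inner h3
  refine tendsto_nhds_unique l1 ?_
  simp_rw [inner_brownianLp_stepIntegralLp hB _ (h1 _)]
  have hsub : Ioc (0 : ℝ) (min s t : ℝ≥0) ⊆ Ioc 0 t :=
    Ioc_subset_Ioc_right (by exact_mod_cast min_le_right s t)
  have hf : IntegrableOn f (Ioc 0 t) := h.1.integrable (by norm_num)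
  refine tendsto_integral_of_L1 f (hf.mono_set hsub).aestronglyMeasurable
    (Eventually.of_forall fun m => (integrable_stepFunction _ _ _).integrableOn) ?_
  have hm : ∀ m, AEStronglyMeasurable (fun x => f x - stepFunction (N m) (τ m) (c m) x)
      (volume.restrict (Ioc (0 : ℝ) t)) := fun m =>
    hf.aestronglyMeasurable.sub (integrable_stepFunction _ _ _).aestronglyMeasurable.restrict
  have hub : Tendsto (fun m => eLpNorm (fun x => f x - stepFunction (N m) (τ m) (c m) x) 2
        (volume.restrict (Ioc (0 : ℝ) t)) *
        (volume.restrict (Ioc (0 : ℝ) t)) univ ^ (1 / (1 : ℝ≥0∞).toReal - 1 / (2 : ℝ≥0∞).toReal))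
        atTop (𝓝 0) := by
    have := ENNReal.Tendsto.mul_const h2 (b := (volume.restrict (Ioc (0 : ℝ) t)) univ ^
      (1 / (1 : ℝ≥0∞).toReal - 1 / (2 : ℝ≥0∞).toReal))
      (Or.inr (ENNReal.rpow_ne_top_of_nonneg (by norm_num) (by simp)))
    simpa using this
  refine tendsto_of_tendsto_of_tendsto_of_le_of_le tendsto_const_nhds hub (fun _ => zero_le)
    fun m => ?_
  refine le_trans (le_trans ?_ (lintegral_mono_set hsub))
    (le_trans (le_of_eq eLpNorm_one_eq_lintegral_enorm.symm)
      (eLpNorm_le_eLpNorm_mul_rpow_measure_univ (by norm_num) (hm m)))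
  refine lintegral_mono fun x => ?_
  rw [enorm_sub_rev]

/-- The Wiener integral of a constant: the difference of the two sides lies in the closed span of the
values of the Brownian motion and is orthogonal to all of them. -/
lemma IsWienerIntegral.ae_eq_const_mul (hB : IsPreBrownianReal B P) {σ : ℝ} {t : ℝ≥0}
    {J : Ω → ℝ} (h : IsWienerIntegral P B (fun _ => σ) t J) :
    ∀ᵐ ω ∂P, J ω = σ * B t ω := by
  set D := h.2.1.toLp J - σ • brownianLp hB t with hD
  have hD1 : D ∈ (brownianSpan hB).topologicalClosure :=
    Submodule.sub_mem _ (h.toLp_mem_closure hB) (Submodule.smul_mem _ _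
      (Submodule.le_topologicalClosure _ (brownianLp_mem_span hB t)))
  have hD2 : ∀ x ∈ Submodule.span ℝ {D}, ∀ y ∈ brownianSpan hB, inner ℝ x y = 0 := by
    intro x hx y hy
    obtain ⟨a, rfl⟩ := Submodule.mem_span_singleton.1 hx
    rw [real_inner_smul_left]
    refine mul_eq_zero_of_right _ ?_
    refine Submodule.span_induction ?_ (inner_zero_right _) ?_ ?_ hy
    · rintro _ ⟨s, rfl⟩
      rw [real_inner_comm, hD, inner_sub_right, h.inner_brownianLp hB, inner_smul_right,
        _root_.inner_brownianLp, setIntegral_const, measureReal_def, Real.volume_Ioc, sub_zero,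
        ENNReal.toReal_ofReal (by positivity), smul_eq_mul, mul_comm, sub_self]
    · intro x y _ _ h1 h2
      rw [inner_add_right, h1, h2, add_zero]
    · intro a x _ h1
      rw [inner_smul_right, h1, mul_zero]
  have h0 : D = 0 := inner_self_eq_zero.1
    (inner_eq_zero_of_mem_closure hD2 (Submodule.mem_span_singleton_self D) hD1)
  have h1 := sub_eq_zero.1 h0
  filter_upwards [h.2.1.coeFn_toLp, Lp.coeFn_smul σ (brownianLp hB t),
    coeFn_brownianLp hB t] with ω a1 a2 a3
  rw [← a1, h1, a2, Pi.smul_apply, a3, smul_eq_mul]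

end Wiener

/-! ### The joint Gaussian structure of the correlated Brownian motions -/

section Model

variable {Ω : Type*} [MeasurableSpace Ω] {P : Measure Ω} {B₁ B₂ B₃ : ℝ≥0 → Ω → ℝ}
  {σ₁ σ₂ ρ : ℝ → ℝ} {b₁ b₂ : ℝ → Ω → ℝ} {X₁ X₂ : ℝ≥0 → Ω → ℝ}

/-- The closed subspace of `L²(P)` generated by the independent Brownian motions `B₁` and `B₃`. -/
noncomputable def IsBivariateIto.gaussianSpace
    (hX : IsBivariateIto P B₁ B₂ B₃ σ₁ σ₂ ρ b₁ b₂ X₁ X₂) : Submodule ℝ (Lp ℝ 2 P) :=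
  (brownianSpan hX.brownian₁.toIsPreBrownianReal ⊔
    brownianSpan hX.brownian₃.toIsPreBrownianReal).topologicalClosure

variable (hX : IsBivariateIto P B₁ B₂ B₃ σ₁ σ₂ ρ b₁ b₂ X₁ X₂)
include hX

lemma IsBivariateIto.isGaussianSubspace [IsProbabilityMeasure P] :
    IsGaussianSubspace hX.gaussianSpace :=
  ((isGaussianSubspace_brownianSpan _).sup (isGaussianSubspace_brownianSpan _)
    fun _ h1 _ h2 => indepFun_of_mem_brownianSpan _ _ hX.indep h1 h2).topologicalClosure

lemma IsBivariateIto.brownianLp₁_mem (t : ℝ≥0) :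
    brownianLp hX.brownian₁.toIsPreBrownianReal t ∈ hX.gaussianSpace :=
  Submodule.le_topologicalClosure _ (Submodule.mem_sup_left (brownianLp_mem_span _ t))

lemma IsBivariateIto.exists_brownianLp₂_eq {t : ℝ≥0} (ht : t ≤ 1) :
    ∃ (J₁ J₃ : Ω → ℝ) (h₁ : IsWienerIntegral P B₁ ρ t J₁)
      (h₃ : IsWienerIntegral P B₃ (fun s => √(1 - ρ s ^ 2)) t J₃),
      brownianLp hX.brownian₂.toIsPreBrownianReal t = h₁.2.1.toLp J₁ + h₃.2.1.toLp J₃ := by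
  obtain ⟨J₁, J₃, h₁, h₃, h⟩ := hX.corr t ht
  refine ⟨J₁, J₃, h₁, h₃, Lp.ext ?_⟩
  filter_upwards [h, h₁.2.1.coeFn_toLp, h₃.2.1.coeFn_toLp,
    coeFn_brownianLp hX.brownian₂.toIsPreBrownianReal t,
    Lp.coeFn_add (h₁.2.1.toLp J₁) (h₃.2.1.toLp J₃)] with ω a1 a2 a3 a4 a5
  rw [a4, a5, Pi.add_apply, a2, a3, a1]

lemma IsBivariateIto.brownianLp₂_mem {t : ℝ≥0} (ht : t ≤ 1) :
    brownianLp hX.brownian₂.toIsPreBrownianReal t ∈ hX.gaussianSpace := by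
  obtain ⟨J₁, J₃, h₁, h₃, h⟩ := hX.exists_brownianLp₂_eq ht
  rw [h]
  exact Submodule.add_mem _
    (Submodule.topologicalClosure_mono le_sup_left (h₁.toLp_mem_closure _))
    (Submodule.topologicalClosure_mono le_sup_right (h₃.toLp_mem_closure _))

/-- The covariance of the two driving Brownian motions: the part of `B₂` that is driven by `B₃` is
orthogonal to `B₁`. -/
lemma IsBivariateIto.inner_brownianLp₁_brownianLp₂ [IsProbabilityMeasure P] (s : ℝ≥0) {t : ℝ≥0}
    (ht : t ≤ 1) : inner ℝ (brownianLp hX.brownian₁.toIsPreBrownianReal s)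
      (brownianLp hX.brownian₂.toIsPreBrownianReal t) =
        ∫ x in Ioc (0 : ℝ) (min s t : ℝ≥0), ρ x := by
  obtain ⟨J₁, J₃, h₁, h₃, h⟩ := hX.exists_brownianLp₂_eq ht
  rw [h, inner_add_right, h₁.inner_brownianLp]
  refine add_eq_left.2 (inner_eq_zero_of_mem_closure (fun x hx y hy => ?_)
    (brownianLp_mem_span _ s) (h₃.toLp_mem_closure hX.brownian₃.toIsPreBrownianReal))
  exact (isGaussianSubspace_brownianSpan hX.brownian₁.toIsPreBrownianReal).inner_eq_zero_of_indepFun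
    hx (indepFun_of_mem_brownianSpan _ _ hX.indep hx hy)

lemma IsBivariateIto.memLp_corr : MemLp ρ 2 (volume.restrict (Ioc (0 : ℝ) 1)) := by
  obtain ⟨J₁, J₃, h₁, -⟩ := hX.corr 1 le_rfl
  simpa using h₁.1

end Model

/-! ### Averages of the correlation over the partition -/

section Averages

lemma sum_integral_partition {f : ℝ → ℝ} (hf : IntegrableOn f (Ioc 0 1)) {n : ℕ} (hn : 1 ≤ n) :
    ∑ k ∈ Finset.range n, ∫ x in (k / n : ℝ)..((k + 1) / n), f x = ∫ x in (0 : ℝ)..1, f x := by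
  have hn' : (0 : ℝ) < n := by exact_mod_cast hn
  have h := intervalIntegral.sum_integral_adjacent_intervals (f := f) (μ := volume)
    (a := fun k : ℕ => (k : ℝ) / n) (n := n) (fun k hk => by
      have h1 : (k : ℝ) / n ≤ ((k + 1 : ℕ) : ℝ) / n := by
        gcongr; exact_mod_cast Nat.le_succ k
      rw [intervalIntegrable_iff_integrableOn_Ioc_of_le h1]
      refine hf.mono_set (Ioc_subset_Ioc (by positivity) ?_)
      rw [div_le_one hn']
      exact_mod_cast hk)
  simpa [div_self hn'.ne'] using h

/-- By Lebesgue's differentiation theorem the averages of a bounded function over the intervals of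
the partition converge almost everywhere, hence in `L²`. -/
lemma tendsto_mul_sum_sq_integral {f : ℝ → ℝ}
    (hf : AEStronglyMeasurable f (volume.restrict (Ioc (0 : ℝ) 1)))
    (h1 : ∀ x ∈ Ioc (0 : ℝ) 1, |f x| ≤ 1) :
    Tendsto (fun n : ℕ => (n : ℝ) * ∑ k ∈ Finset.range n,
      (∫ x in (k / n : ℝ)..((k + 1) / n), f x) ^ 2) atTop (𝓝 (∫ x in (0 : ℝ)..1, f x ^ 2)) := by
  have hint : IntegrableOn f (Ioc 0 1) :=
    Integrable.of_bound hf 1 ((ae_restrict_mem measurableSet_Ioc).mono fun x hx => h1 x hx)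
  set d : ℕ → ℕ → ℝ := fun n k => ∫ x in (k / n : ℝ)..((k + 1) / n), f x with hd
  -- the conditional expectation of `f` given the partition into intervals of length `1 / n`
  set F : ℕ → ℝ → ℝ := fun n x => n * d n (⌈n * x⌉₊ - 1) with hF
  have hle : ∀ (n k : ℕ), ((k : ℝ) / n) ≤ (k + 1) / n := fun n k => by
    gcongr; linarith
  -- the index of the interval that contains `x`
  have hceil : ∀ {n k : ℕ} {x : ℝ}, 1 ≤ n → x ∈ Ioc (k / n : ℝ) ((k + 1) / n) →
      ⌈n * x⌉₊ = k + 1 := by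
    intro n k x hn hx
    have hn' : (0 : ℝ) < n := by exact_mod_cast hn
    rw [Nat.ceil_eq_iff (by omega)]
    have a1 := (div_lt_iff₀ hn').1 hx.1
    have a2 := (le_div_iff₀ hn').1 hx.2
    constructor
    · simp; linarith
    · push_cast; linarith
  have hmem : ∀ {n : ℕ} {x : ℝ}, 1 ≤ n → x ∈ Ioc (0 : ℝ) 1 →
      ⌈n * x⌉₊ - 1 < n ∧ x ∈ Ioc (((⌈n * x⌉₊ - 1 : ℕ) : ℝ) / n)
        ((((⌈n * x⌉₊ - 1 : ℕ) : ℝ) + 1) / n) := by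
    intro n x hn hx
    have hn' : (0 : ℝ) < n := by exact_mod_cast hn
    have hpos : 0 < (n : ℝ) * x := mul_pos hn' hx.1
    have hc : 1 ≤ ⌈n * x⌉₊ := Nat.one_le_ceil_iff.2 hpos
    have hle' : ⌈n * x⌉₊ ≤ n := Nat.ceil_le.2 (by nlinarith [hx.2])
    refine ⟨by omega, ?_, ?_⟩
    · rw [div_lt_iff₀ hn', Nat.cast_sub hc, Nat.cast_one]
      linarith [Nat.ceil_lt_add_one hpos.le]
    · rw [le_div_iff₀ hn', Nat.cast_sub hc, Nat.cast_one]
      linarith [Nat.le_ceil ((n : ℝ) * x)]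
  have hsub : ∀ {n k : ℕ}, 1 ≤ n → k < n → Ioc (k / n : ℝ) ((k + 1) / n) ⊆ Ioc 0 1 := by
    intro n k hn hk
    have hn' : (0 : ℝ) < n := by exact_mod_cast hn
    refine Ioc_subset_Ioc (by positivity) ?_
    rw [div_le_one hn']
    exact_mod_cast hk
  have hbound : ∀ {n k : ℕ}, 1 ≤ n → k < n → |(n : ℝ) * d n k| ≤ 1 := by
    intro n k hn hk
    have hn' : (0 : ℝ) < n := by exact_mod_cast hn
    have := intervalIntegral.norm_integral_le_of_norm_le_const (C := 1) (f := f)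
      (a := (k / n : ℝ)) (b := (k + 1) / n) (fun x hx => by
        rw [uIoc_of_le (hle n k)] at hx
        exact h1 x (hsub hn hk hx))
    rw [Real.norm_eq_abs] at this
    rw [abs_mul, abs_of_pos hn']
    have e : ((k : ℝ) + 1) / n - k / n = 1 / n := by ring
    rw [e, abs_of_pos (show (0 : ℝ) < 1 / n by positivity)] at this
    calc (n : ℝ) * |d n k| ≤ n * (1 * (1 / n)) := by gcongr
      _ = 1 := by field_simp
  have hFm : ∀ n, Measurable (F n) := by
    intro n
    have : Measurable fun k : ℕ => (n : ℝ) * d n (k - 1) := measurable_from_nat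
    exact this.comp (Nat.measurable_ceil.comp (measurable_const_mul _))
  have hFint : ∀ n, 1 ≤ n → IntegrableOn (fun x => F n x ^ 2) (Ioc 0 1) := by
    intro n hn
    refine Integrable.of_bound ((hFm n).pow_const 2).aestronglyMeasurable 1
      ((ae_restrict_mem measurableSet_Ioc).mono fun x hx => ?_)
    rw [norm_pow, Real.norm_eq_abs]
    exact pow_le_one₀ (abs_nonneg _) (hbound hn (hmem hn hx).1)
  have hsum : ∀ n : ℕ, 1 ≤ n → ∫ x in (0 : ℝ)..1, F n x ^ 2 =
      n * ∑ k ∈ Finset.range n, d n k ^ 2 := by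
    intro n hn
    have hn' : (0 : ℝ) < n := by exact_mod_cast hn
    rw [← sum_integral_partition (hFint n hn) hn, Finset.mul_sum]
    refine Finset.sum_congr rfl fun k _ => ?_
    have : ∫ x in (k / n : ℝ)..((k + 1) / n), F n x ^ 2 =
        ∫ x in (k / n : ℝ)..((k + 1) / n), (n * d n k) ^ 2 := by
      rw [intervalIntegral.integral_of_le (hle n k), intervalIntegral.integral_of_le (hle n k)]
      refine setIntegral_congr_fun measurableSet_Ioc fun x hx => ?_
      simp only [hF, hceil hn hx, Nat.add_sub_cancel]
    rw [this, intervalIntegral.integral_const, smul_eq_mul]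
    field_simp
    ring
  have hconv : ∀ᵐ x ∂(volume.restrict (Ioc (0 : ℝ) 1)),
      Tendsto (fun n => F n x) atTop (𝓝 (f x)) := by
    have hloc : LocallyIntegrable ((Ioc (0 : ℝ) 1).indicator f) :=
      ((integrable_indicator_iff measurableSet_Ioc).2 hint).locallyIntegrable
    filter_upwards [ae_restrict_mem measurableSet_Ioc,
      ae_restrict_of_ae (IsUnifLocDoublingMeasure.ae_tendsto_average (μ := volume) hloc 1)]
      with x hx h
    have hδ : Tendsto (fun n : ℕ => 1 / (2 * (n : ℝ))) atTop (𝓝[>] 0) := by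
      refine tendsto_nhdsWithin_iff.2 ⟨?_, ?_⟩
      · have := tendsto_one_div_atTop_nhds_zero_nat (𝕜 := ℝ)
        have := this.const_mul (1 / 2)
        simp only [mul_zero] at this
        refine this.congr fun n => by rw [div_mul_div_comm, one_mul]
      · filter_upwards [eventually_ge_atTop 1] with n hn
        have hn' : (0 : ℝ) < n := by exact_mod_cast hn
        simp only [mem_Ioi]; positivity
    set w : ℕ → ℝ := fun n => ((⌈n * x⌉₊ - 1 : ℕ) : ℝ) / n + 1 / (2 * n) with hw
    have hball : ∀ n : ℕ, Metric.closedBall (w n) (1 / (2 * n)) =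
        Icc (((⌈n * x⌉₊ - 1 : ℕ) : ℝ) / n) ((((⌈n * x⌉₊ - 1 : ℕ) : ℝ) + 1) / n) := by
      intro n
      rw [Real.closedBall_eq_Icc]
      simp only [hw]
      congr 1 <;> ring
    have hlim := h w (fun n : ℕ => 1 / (2 * (n : ℝ))) hδ (by
      filter_upwards [eventually_ge_atTop 1] with n hn
      rw [one_mul, hball]
      exact Ioc_subset_Icc_self (hmem hn hx).2)
    rw [indicator_of_mem hx] at hlim
    refine hlim.congr' ?_
    filter_upwards [eventually_ge_atTop 1] with n hn
    have hn' : (0 : ℝ) < n := by exact_mod_cast hn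
    set k := ⌈n * x⌉₊ - 1 with hk
    rw [hball, setAverage_eq, measureReal_def, Real.volume_Icc, integral_Icc_eq_integral_Ioc,
      setIntegral_indicator measurableSet_Ioc, inter_eq_left.2 (hsub hn (hmem hn hx).1)]
    have e : ((k : ℝ) + 1) / n - k / n = 1 / n := by ring
    rw [e, ENNReal.toReal_ofReal (by positivity), one_div, inv_inv, smul_eq_mul]
    simp only [hF, hd]
    rw [intervalIntegral.integral_of_le (hle n _)]
  have hdct : Tendsto (fun n => ∫ x in Ioc (0 : ℝ) 1, F n x ^ 2) atTop
      (𝓝 (∫ x in Ioc (0 : ℝ) 1, f x ^ 2)) := by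
    refine tendsto_integral_filter_of_dominated_convergence (fun _ => 1) ?_ ?_ ?_ ?_
    · exact Eventually.of_forall fun n => ((hFm n).pow_const 2).aestronglyMeasurable
    · filter_upwards [eventually_ge_atTop 1] with n hn
      refine (ae_restrict_mem measurableSet_Ioc).mono fun x hx => ?_
      rw [norm_pow, Real.norm_eq_abs]
      exact pow_le_one₀ (abs_nonneg _) (hbound hn (hmem hn hx).1)
    · exact integrable_const _
    · exact hconv.mono fun x hx => hx.pow 2
  rw [intervalIntegral.integral_of_le zero_le_one]
  refine hdct.congr' ?_
  filter_upwards [eventually_ge_atTop 1] with n hn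
  rw [← hsum n hn, intervalIntegral.integral_of_le zero_le_one]

end Averages

/-! ### The rate function -/

section Rate

/-- The asymptotic variance of the realized correlation; `r = ∫ ρ` and `m = ∫ ρ²`. -/
def corrVariance (r m : ℝ) : ℝ := (1 + r ^ 2) * (1 + m) - 4 * r ^ 2

lemma corrVariance_pos {r m : ℝ} (hr : |r| < 1) (hm : r ^ 2 ≤ m) : 0 < corrVariance r m := by
  have h1 : r ^ 2 < 1 := (sq_lt_one_iff_abs_lt_one r).2 hr
  unfold corrVariance
  nlinarith [sq_nonneg r, mul_pos (sub_pos.2 h1) (sub_pos.2 h1)]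

lemma asympCov_const (s t : ℝ) {ρ : ℝ → ℝ}
    (h : IntervalIntegrable (fun x => ρ x ^ 2) volume 0 1) :
    asympCov (fun _ => s) (fun _ => t) ρ =
      !![2 * s ^ 4, 2 * (s ^ 2 * t ^ 2 * ∫ x in (0 : ℝ)..1, ρ x ^ 2),
          2 * (s ^ 3 * t * ∫ x in (0 : ℝ)..1, ρ x);
        2 * (s ^ 2 * t ^ 2 * ∫ x in (0 : ℝ)..1, ρ x ^ 2), 2 * t ^ 4,
          2 * (s * t ^ 3 * ∫ x in (0 : ℝ)..1, ρ x);
        2 * (s ^ 3 * t * ∫ x in (0 : ℝ)..1, ρ x), 2 * (s * t ^ 3 * ∫ x in (0 : ℝ)..1, ρ x),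
          s ^ 2 * t ^ 2 * (1 + ∫ x in (0 : ℝ)..1, ρ x ^ 2)] := by
  have e : ∫ x in (0 : ℝ)..1, (1 + ρ x ^ 2) = 1 + ∫ x in (0 : ℝ)..1, ρ x ^ 2 := by
    rw [intervalIntegral.integral_add (by simp) h]
    simp
  unfold asympCov
  simp only [intervalIntegral.integral_const_mul, e, intervalIntegral.integral_const, sub_zero,
    one_smul]

/-- The quadratic form of the asymptotic covariance matrix, in coordinates that are normalized by
the volatilities. -/
def covForm (r m a b c : ℝ) : ℝ :=
  2 * a ^ 2 + 2 * b ^ 2 + 4 * m * a * b + 4 * r * (a + b) * c + (1 + m) * c ^ 2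

/-- The form is an average of covariance forms; in terms of `m` it is positive semidefinite for
`r ^ 2 ≤ m ≤ 1`, the range allowed by the Cauchy-Schwarz inequality and `|ρ| ≤ 1`. -/
lemma covForm_nonneg {r m : ℝ} (hm : r ^ 2 ≤ m) (hm1 : m ≤ 1) (a b c : ℝ) :
    0 ≤ covForm r m a b c := by
  have e : covForm r m a b c = (1 - m) * (a - b) ^ 2 + (m - r ^ 2) * ((a + b) ^ 2 + c ^ 2) +
      (1 + r ^ 2) * ((a + b) ^ 2 + c ^ 2) + 4 * r * (a + b) * c := by
    unfold covForm; ring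
  have h : 0 ≤ (1 + r ^ 2) * ((a + b) ^ 2 + c ^ 2) + 4 * r * (a + b) * c := by
    nlinarith [sq_nonneg (a + b + r * c), sq_nonneg (c + r * (a + b))]
  have h1 : 0 ≤ (1 - m) * (a - b) ^ 2 := mul_nonneg (by linarith) (sq_nonneg _)
  have h2 : 0 ≤ (m - r ^ 2) * ((a + b) ^ 2 + c ^ 2) := mul_nonneg (by linarith) (by positivity)
  rw [e]; linarith

/-- The contraction of the Gaussian rate function along the differential of the correlation is
again Gaussian: the supremum defining `rateMDP` is bounded below through the direction of that
differential, and the infimum is attained on its image under the covariance matrix. -/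
lemma rateCorr_eq {s t : ℝ} (hs : 0 < s) (ht : 0 < t) {ρ : ℝ → ℝ}
    (h : IntervalIntegrable (fun x => ρ x ^ 2) volume 0 1) {r m : ℝ}
    (hr : r = ∫ x in (0 : ℝ)..1, ρ x) (hm : m = ∫ x in (0 : ℝ)..1, ρ x ^ 2)
    (hr1 : |r| < 1) (hrm : r ^ 2 ≤ m) (hm1 : m ≤ 1) (u : ℝ) :
    rateCorr s t ρ u = ENNReal.ofReal (u ^ 2 / (2 * corrVariance r m)) := by
  have hv := corrVariance_pos hr1 hrm
  set v := corrVariance r m with hvdef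
  have hquad : ∀ l : Fin 3 → ℝ, l ⬝ᵥ (asympCov (fun _ => s) (fun _ => t) ρ *ᵥ l) =
      covForm r m (s ^ 2 * l 0) (t ^ 2 * l 1) (s * t * l 2) := by
    intro l
    rw [asympCov_const s t h, ← hr, ← hm]
    simp [dotProduct, Matrix.mulVec, Fin.sum_univ_three, covForm]
    ring
  unfold rateCorr rateMDP
  simp only [hquad, ← hr]
  refine le_antisymm ?_ ?_
  · -- the point is `u / v` times the covariance matrix applied to the differential
    refine iInf_le_of_le (s ^ 2 * (u / v * (-r - m * r + 2 * r))) (iInf_le_of_le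
      (t ^ 2 * (u / v * (-r - m * r + 2 * r))) (iInf_le_of_le
      (s * t * (u / v * (1 + m - 2 * r ^ 2))) (iInf_le_of_le ?_ ?_)))
    · have : u = u / v * v := by field_simp
      rw [hvdef, corrVariance] at this
      field_simp
      rw [hvdef, corrVariance]
      field_simp
      ring
    · refine iSup_le fun l => ENNReal.ofReal_le_ofReal ?_
      -- complete the square around the direction of the differential
      have hn := covForm_nonneg hrm hm1 (s ^ 2 * l 0 + u / v * (r / 2))
        (t ^ 2 * l 1 + u / v * (r / 2)) (s * t * l 2 - u / v)
      have hu : u ^ 2 / (2 * v) = (u / v) ^ 2 * v / 2 := by field_simp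
      rw [hu]
      generalize u / v = w at *
      rw [hvdef, corrVariance]
      simp only [dotProduct, Fin.sum_univ_three, Matrix.cons_val]
      unfold covForm at *
      nlinarith
  · refine le_iInf fun x => le_iInf fun y => le_iInf fun z => le_iInf fun hu => ?_
    refine le_iSup_of_le ![u / v * (-r / (2 * s ^ 2)), u / v * (-r / (2 * t ^ 2)),
      u / v * (1 / (s * t))] (ENNReal.ofReal_le_ofReal (le_of_eq ?_))
    simp only [dotProduct, Fin.sum_univ_three, Matrix.cons_val]
    have e1 : u / v * (-r / (2 * s ^ 2)) * x + u / v * (-r / (2 * t ^ 2)) * y +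
        u / v * (1 / (s * t)) * z = u / v * u := by
      conv_rhs => rw [hu]
      conv_lhs => rw [hu]
      field_simp
      ring
    have e2 : covForm r m (s ^ 2 * (u / v * (-r / (2 * s ^ 2))))
        (t ^ 2 * (u / v * (-r / (2 * t ^ 2)))) (s * t * (u / v * (1 / (s * t)))) =
        (u / v) ^ 2 * v := by
      rw [show s ^ 2 * (u / v * (-r / (2 * s ^ 2))) = u / v * (-r / 2) by field_simp,
        show t ^ 2 * (u / v * (-r / (2 * t ^ 2))) = u / v * (-r / 2) by field_simp,
        show s * t * (u / v * (1 / (s * t))) = u / v by field_simp]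
      generalize u / v = w
      rw [hvdef, corrVariance, covForm]
      ring
    rw [e1, e2]
    field_simp
    ring

end Rate

/-! ### Realized (co-)volatility of Brownian motions -/

section Realized

lemma realizedVol_one {Ω : Type*} {X : ℝ≥0 → Ω → ℝ} (n : ℕ) (ω : Ω) :
    realizedVol n 1 X ω = ∑ k ∈ Finset.range n, increment n X k ω ^ 2 := by
  rw [realizedVol, mul_one, Nat.floor_natCast]

lemma realizedCov_one {Ω : Type*} {X Y : ℝ≥0 → Ω → ℝ} (n : ℕ) (ω : Ω) :
    realizedCov n 1 X Y ω = ∑ k ∈ Finset.range n, increment n X k ω * increment n Y k ω := by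
  rw [realizedCov, mul_one, Nat.floor_natCast]

variable {Ω : Type*} [MeasurableSpace Ω] {P : Measure Ω}

lemma HasQuadraticCGFLimit.congr {L L' : ℕ → Ω → ℝ} {a : ℕ → ℝ} {v : ℝ}
    (h : HasQuadraticCGFLimit P L a v) (hLL' : ∀ᶠ n in atTop, L n =ᵐ[P] L' n) :
    HasQuadraticCGFLimit P L' a v := by
  intro l
  refine ⟨?_, (h l).2.congr' ?_⟩
  · filter_upwards [(h l).1, hLL'] with n h1 h2
    refine h1.congr ?_
    filter_upwards [h2] with ω hω
    rw [hω]
  · filter_upwards [hLL'] with n h2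
    rw [cgf, cgf, mgf_congr h2]

/-- The increment of a Brownian motion over the `k`-th interval of the partition, in `L²(P)`. -/
noncomputable def incrementLp {B : ℝ≥0 → Ω → ℝ} (hB : IsPreBrownianReal B P) (n k : ℕ) :
    Lp ℝ 2 P :=
  brownianLp hB (((k : ℝ≥0) + 1) / n) - brownianLp hB ((k : ℝ≥0) / n)

lemma coeFn_incrementLp {B : ℝ≥0 → Ω → ℝ} (hB : IsPreBrownianReal B P) (n k : ℕ) :
    incrementLp hB n k =ᵐ[P] increment n B k := by
  filter_upwards [Lp.coeFn_sub (brownianLp hB (((k : ℝ≥0) + 1) / n)) (brownianLp hB ((k : ℝ≥0) / n)),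
    coeFn_brownianLp hB (((k : ℝ≥0) + 1) / n), coeFn_brownianLp hB ((k : ℝ≥0) / n)] with ω h1 h2 h3
  rw [incrementLp, h1, Pi.sub_apply, h2, h3, increment]

/-- Kernels of the form `R (min s t)` have uncorrelated increments. -/
lemma increment_min (R : ℝ≥0 → ℝ) (n k l : ℕ) :
    R (min (((k : ℝ≥0) + 1) / n) (((l : ℝ≥0) + 1) / n)) - R (min ((k : ℝ≥0) / n) (((l : ℝ≥0) + 1) / n))
      - (R (min (((k : ℝ≥0) + 1) / n) ((l : ℝ≥0) / n)) - R (min ((k : ℝ≥0) / n) ((l : ℝ≥0) / n))) =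
      if k = l then R (((k : ℝ≥0) + 1) / n) - R ((k : ℝ≥0) / n) else 0 := by
  have hmono : ∀ {x y : ℝ≥0}, x ≤ y → x / n ≤ y / n := fun h => by gcongr
  have hs : ∀ i : ℕ, (i : ℝ≥0) ≤ i + 1 := fun i => le_self_add
  rcases lt_trichotomy k l with h | rfl | h
  · have h1 : (k : ℝ≥0) + 1 ≤ l := by exact_mod_cast h
    have h2 : (k : ℝ≥0) ≤ l := (hs k).trans h1
    rw [min_eq_left (hmono (h1.trans (hs l))), min_eq_left (hmono (h2.trans (hs l))),
      min_eq_left (hmono h1), min_eq_left (hmono h2), if_neg h.ne]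
    ring
  · rw [min_self, min_self, min_eq_left (hmono (hs k)), min_eq_right (hmono (hs k)), if_pos rfl]
    ring
  · have h1 : (l : ℝ≥0) + 1 ≤ k := by exact_mod_cast h
    have h2 : (l : ℝ≥0) ≤ k := (hs l).trans h1
    rw [min_eq_right (hmono (h1.trans (hs k))), min_eq_right (hmono h1),
      min_eq_right (hmono (h2.trans (hs k))), min_eq_right (hmono h2), if_neg h.ne']
    ring

lemma inner_incrementLp {B : ℝ≥0 → Ω → ℝ} (hB : IsPreBrownianReal B P) (n k l : ℕ) :
    inner ℝ (incrementLp hB n k) (incrementLp hB n l) = if k = l then 1 / (n : ℝ) else 0 := by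
  rw [incrementLp, incrementLp, inner_sub_right, inner_sub_left, inner_sub_left,
    inner_brownianLp, inner_brownianLp, inner_brownianLp, inner_brownianLp,
    increment_min (fun x => (x : ℝ))]
  congr 1
  push_cast
  ring

/-- Moderate deviations of the realized volatility of a single Brownian motion. -/
lemma hasQuadraticCGFLimit_realizedVol [IsProbabilityMeasure P] {B : ℝ≥0 → Ω → ℝ}
    (hB : IsPreBrownianReal B P) {b : ℕ → ℝ}
    (hb : Tendsto b atTop atTop) (hbn : Tendsto (fun n : ℕ => b n / √n) atTop (𝓝 0)) :
    HasQuadraticCGFLimit P (fun n ω => √n / b n * (realizedVol n 1 B ω - 1))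
      (fun n => b n ^ 2) 2 := by
  have hnorm : ∀ n k, ‖incrementLp hB n k‖ ^ 2 = 1 / (n : ℝ) := fun n k => by
    rw [← real_inner_self_eq_norm_sq, inner_incrementLp, if_pos rfl]
  have h := (isGaussianSubspace_brownianSpan hB).hasQuadraticCGFLimit (v := 2) (C := 1)
    (ι := fun n => Fin n) (Z := fun n i => incrementLp hB n i) (a := fun _ _ => 1)
    (fun n i => Submodule.sub_mem _ (brownianLp_mem_span hB _) (brownianLp_mem_span hB _)) hb hbn
    (fun n => by simp; omega)
    (fun n _ i j hij => (inner_incrementLp hB n i j).trans (if_neg fun h => hij (Fin.ext h)))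
    (fun n hn i => by
      have hn' : (0 : ℝ) < n := by exact_mod_cast hn
      rw [hnorm, one_mul, abs_of_pos (by positivity)])
    (by
      refine tendsto_const_nhds.congr' ?_
      filter_upwards [eventually_ge_atTop 1] with n hn
      have hn' : (0 : ℝ) < n := by exact_mod_cast hn
      simp only [hnorm, Finset.sum_const, Finset.card_univ, Fintype.card_fin, nsmul_eq_mul]
      field_simp)
  refine h.congr ?_
  filter_upwards [eventually_ge_atTop 1] with n hn
  have hn' : (0 : ℝ) < n := by exact_mod_cast hn
  filter_upwards [ae_all_iff.2 fun k => coeFn_incrementLp hB n k] with ω hω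
  rw [realizedVol_one, Finset.sum_range]
  simp only [hω, hnorm, one_mul, Finset.sum_const, Finset.card_univ, Fintype.card_fin,
    nsmul_eq_mul]
  congr 2
  field_simp

end Realized

/-! ### The linearized statistic of the correlated Brownian motions -/

section RealizedCov

variable {Ω : Type*} [MeasurableSpace Ω] {P : Measure Ω} {B₁ B₂ B₃ : ℝ≥0 → Ω → ℝ}
  {σ₁ σ₂ ρ : ℝ → ℝ} {b₁ b₂ : ℝ → Ω → ℝ} {X₁ X₂ : ℝ≥0 → Ω → ℝ}

lemma IsBivariateIto.integrableOn_corr (hX : IsBivariateIto P B₁ B₂ B₃ σ₁ σ₂ ρ b₁ b₂ X₁ X₂) :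
    IntegrableOn ρ (Ioc 0 1) :=
  hX.memLp_corr.integrable (by norm_num)

lemma IsBivariateIto.abs_corr_lt (hX : IsBivariateIto P B₁ B₂ B₃ σ₁ σ₂ ρ b₁ b₂ X₁ X₂) {x : ℝ}
    (hx : x ∈ Ioc (0 : ℝ) 1) : |ρ x| < 1 :=
  abs_lt.2 (hX.corr_mem x (Ioc_subset_Icc_self hx))

lemma grid_le_one {n k : ℕ} (hk : k < n) : ((k : ℝ≥0) + 1) / n ≤ 1 ∧ (k : ℝ≥0) / n ≤ 1 := by
  have hn : (0 : ℝ≥0) < n := by exact_mod_cast (Nat.zero_le k).trans_lt hk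
  constructor
  · rw [div_le_one hn]; exact_mod_cast hk
  · rw [div_le_one hn]; exact_mod_cast hk.le

lemma IsBivariateIto.inner_incrementLp₁_incrementLp₂ [IsProbabilityMeasure P]
    (hX : IsBivariateIto P B₁ B₂ B₃ σ₁ σ₂ ρ b₁ b₂ X₁ X₂) {n k l : ℕ} (hk : k < n) (hl : l < n) :
    inner ℝ (incrementLp hX.brownian₁.toIsPreBrownianReal n k)
      (incrementLp hX.brownian₂.toIsPreBrownianReal n l) =
      if k = l then ∫ x in (k / n : ℝ)..((k + 1) / n), ρ x else 0 := by
  rw [incrementLp, incrementLp, inner_sub_right, inner_sub_left, inner_sub_left,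
    hX.inner_brownianLp₁_brownianLp₂ _ (grid_le_one hl).1,
    hX.inner_brownianLp₁_brownianLp₂ _ (grid_le_one hl).1,
    hX.inner_brownianLp₁_brownianLp₂ _ (grid_le_one hl).2,
    hX.inner_brownianLp₁_brownianLp₂ _ (grid_le_one hl).2,
    increment_min (fun u => ∫ x in Ioc (0 : ℝ) u, ρ x)]
  congr 1
  have hii : ∀ u : ℝ≥0, u ≤ 1 → IntervalIntegrable ρ volume 0 u := fun u hu => by
    refine (intervalIntegrable_iff_integrableOn_Ioc_of_le (NNReal.coe_nonneg u)).2 ?_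
    exact hX.integrableOn_corr.mono_set (Ioc_subset_Ioc_right (by exact_mod_cast hu))
  rw [← intervalIntegral.integral_of_le (NNReal.coe_nonneg _),
    ← intervalIntegral.integral_of_le (NNReal.coe_nonneg _),
    intervalIntegral.integral_interval_sub_left (hii _ (grid_le_one hk).1)
      (hii _ (grid_le_one hk).2)]
  push_cast
  rfl

/-- The linearization of the realized correlation of the correlated Brownian motions. In terms of
the independent increments of `B₁ + B₂` and `B₁ - B₂` it is a diagonal quadratic form. -/
lemma IsBivariateIto.hasQuadraticCGFLimit [IsProbabilityMeasure P]
    (hX : IsBivariateIto P B₁ B₂ B₃ σ₁ σ₂ ρ b₁ b₂ X₁ X₂) {b : ℕ → ℝ}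
    (hb : Tendsto b atTop atTop) (hbn : Tendsto (fun n : ℕ => b n / √n) atTop (𝓝 0)) {r m : ℝ}
    (hr : r = ∫ x in (0 : ℝ)..1, ρ x) (hm : m = ∫ x in (0 : ℝ)..1, ρ x ^ 2) (hr1 : |r| ≤ 1) :
    HasQuadraticCGFLimit P (fun n ω => √n / b n * (realizedCov n 1 B₁ B₂ ω -
      r / 2 * (realizedVol n 1 B₁ ω + realizedVol n 1 B₂ ω))) (fun n => b n ^ 2)
      (corrVariance r m) := by
  set β₁ := incrementLp hX.brownian₁.toIsPreBrownianReal with hβ₁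
  set β₂ := incrementLp hX.brownian₂.toIsPreBrownianReal with hβ₂
  set c : ℕ → ℕ → ℝ := fun n k => ∫ x in (k / n : ℝ)..((k + 1) / n), ρ x with hc
  have i11 : ∀ n k l, inner ℝ (β₁ n k) (β₁ n l) = if k = l then 1 / (n : ℝ) else 0 :=
    fun n k l => inner_incrementLp _ n k l
  have i22 : ∀ n k l, inner ℝ (β₂ n k) (β₂ n l) = if k = l then 1 / (n : ℝ) else 0 :=
    fun n k l => inner_incrementLp _ n k l
  have i12 : ∀ n (k l : Fin n), inner ℝ (β₁ n k) (β₂ n l) = if k = l then c n k else 0 :=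
    fun n k l => by
      rw [hX.inner_incrementLp₁_incrementLp₂ k.2 l.2]
      simp only [Fin.ext_iff, hc]
  have i21 : ∀ n (k l : Fin n), inner ℝ (β₂ n k) (β₁ n l) = if k = l then c n k else 0 :=
    fun n k l => by
      rw [real_inner_comm, i12]
      rcases eq_or_ne k l with rfl | h
      · rfl
      · rw [if_neg h, if_neg h.symm]
  have hcabs : ∀ n (k : Fin n), |c n k| ≤ 1 / n := by
    intro n k
    have := abs_real_inner_le_norm (β₁ n k) (β₂ n k)
    rw [i12, if_pos rfl] at this
    have h1 : ‖β₁ n k‖ ^ 2 = 1 / (n : ℝ) := by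
      rw [← real_inner_self_eq_norm_sq, i11, if_pos rfl]
    have h2 : ‖β₂ n k‖ ^ 2 = 1 / (n : ℝ) := by
      rw [← real_inner_self_eq_norm_sq, i22, if_pos rfl]
    nlinarith [sq_nonneg (‖β₁ n k‖ - ‖β₂ n k‖)]
  set Z : ∀ n, Fin n ⊕ Fin n → Lp ℝ 2 P := fun n =>
    Sum.elim (fun k => β₁ n k + β₂ n k) (fun k => β₁ n k - β₂ n k) with hZ
  set a : ∀ n, Fin n ⊕ Fin n → ℝ := fun n =>
    Sum.elim (fun _ => (1 - r) / 4) (fun _ => -(1 + r) / 4) with ha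
  have np : ∀ n (k : Fin n), ‖β₁ n k + β₂ n k‖ ^ 2 = 2 * (1 / n + c n k) := fun n k => by
    rw [← real_inner_self_eq_norm_sq, inner_add_left, inner_add_right, inner_add_right, i11, i12,
      i21, i22]
    simp only [if_true]
    ring
  have nq : ∀ n (k : Fin n), ‖β₁ n k - β₂ n k‖ ^ 2 = 2 * (1 / n - c n k) := fun n k => by
    rw [← real_inner_self_eq_norm_sq, inner_sub_left, inner_sub_right, inner_sub_right, i11, i12,
      i21, i22]
    simp only [if_true]
    ring
  have hmem : ∀ n i, Z n i ∈ hX.gaussianSpace := by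
    have m1 : ∀ n k : ℕ, β₁ n k ∈ hX.gaussianSpace := fun n k =>
      Submodule.sub_mem _ (hX.brownianLp₁_mem _) (hX.brownianLp₁_mem _)
    have m2 : ∀ n, ∀ k : Fin n, β₂ n k ∈ hX.gaussianSpace := fun n k =>
      Submodule.sub_mem _ (hX.brownianLp₂_mem (grid_le_one k.2).1)
        (hX.brownianLp₂_mem (grid_le_one k.2).2)
    rintro n (k | k)
    · exact Submodule.add_mem _ (m1 n k) (m2 n k)
    · exact Submodule.sub_mem _ (m1 n k) (m2 n k)
  have horth : ∀ n, Pairwise fun i j => inner ℝ (Z n i) (Z n j) = 0 := by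
    have hne : ∀ {n} {k l : Fin n}, k ≠ l → (k : ℕ) ≠ l := fun h h' => h (Fin.ext h')
    rintro n (k | k) (l | l) hkl
    · have h : k ≠ l := fun h => hkl (by rw [h])
      simp only [hZ, Sum.elim_inl, inner_add_left, inner_add_right, i11, i12, i21, i22, if_neg h,
        if_neg (hne h), add_zero]
    · simp only [hZ, Sum.elim_inl, Sum.elim_inr, inner_add_left, inner_sub_right, i11, i12, i21,
        i22]
      ring
    · simp only [hZ, Sum.elim_inl, Sum.elim_inr, inner_sub_left, inner_add_right, i11, i12, i21,
        i22]
      ring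
    · have h : k ≠ l := fun h => hkl (by rw [h])
      simp only [hZ, Sum.elim_inr, inner_sub_left, inner_sub_right, i11, i12, i21, i22, if_neg h,
        if_neg (hne h), sub_zero]
  have hsumc : ∀ n : ℕ, 1 ≤ n → ∑ k : Fin n, c n k = r := by
    intro n hn
    rw [hr, ← sum_integral_partition hX.integrableOn_corr hn, Finset.sum_range]
  have habs := abs_le.1 hr1
  have hbd : ∀ n, 1 ≤ n → ∀ i, |a n i * ‖Z n i‖ ^ 2| ≤ 2 / n := by
    intro n hn
    have hn' : (0 : ℝ) < n := by exact_mod_cast hn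
    rintro (k | k)
    · simp only [ha, hZ, Sum.elim_inl, np]
      have h1 := abs_le.1 (hcabs n k)
      rw [abs_of_nonneg (mul_nonneg (by linarith) (by linarith))]
      calc (1 - r) / 4 * (2 * (1 / n + c n k)) ≤ 2 / 4 * (2 * (1 / n + 1 / n)) := by
            have : 0 ≤ 1 / (n : ℝ) + c n k := by linarith
            gcongr <;> linarith
        _ = 2 / n := by ring
    · simp only [ha, hZ, Sum.elim_inr, nq]
      have h1 := abs_le.1 (hcabs n k)
      rw [neg_div, neg_mul, abs_neg, abs_of_nonneg (mul_nonneg (by linarith) (by linarith))]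
      calc (1 + r) / 4 * (2 * (1 / n - c n k)) ≤ 2 / 4 * (2 * (1 / n - -(1 / n))) := by
            have : 0 ≤ 1 / (n : ℝ) - c n k := by linarith
            gcongr <;> linarith
        _ = 2 / n := by ring
  have hlim : Tendsto (fun n : ℕ => n * ∑ i, (a n i * ‖Z n i‖ ^ 2) ^ 2) atTop
      (𝓝 (corrVariance r m / 2)) := by
    have h := tendsto_mul_sum_sq_integral hX.integrableOn_corr.aestronglyMeasurable
      (fun x hx => (hX.abs_corr_lt hx).le)
    rw [← hm] at h
    have h' : Tendsto (fun n : ℕ => ((1 - r) ^ 2 * (1 + 2 * r + n * ∑ k : Fin n, c n k ^ 2) +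
        (1 + r) ^ 2 * (1 - 2 * r + n * ∑ k : Fin n, c n k ^ 2)) / 4) atTop
        (𝓝 (((1 - r) ^ 2 * (1 + 2 * r + m) + (1 + r) ^ 2 * (1 - 2 * r + m)) / 4)) := by
      have h2 : Tendsto (fun n : ℕ => (n : ℝ) * ∑ k : Fin n, c n k ^ 2) atTop (𝓝 m) :=
        h.congr fun n => by rw [Finset.sum_range]
      exact (((tendsto_const_nhds.add h2).const_mul _).add
        ((tendsto_const_nhds.add h2).const_mul _)).div_const _
    have e : ((1 - r) ^ 2 * (1 + 2 * r + m) + (1 + r) ^ 2 * (1 - 2 * r + m)) / 4 =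
        corrVariance r m / 2 := by unfold corrVariance; ring
    rw [e] at h'
    refine h'.congr' ?_
    filter_upwards [eventually_ge_atTop 1] with n hn
    have hn' : (0 : ℝ) < n := by exact_mod_cast hn
    rw [Fintype.sum_sum_type]
    simp only [ha, hZ, Sum.elim_inl, Sum.elim_inr, np, nq]
    have e1 : ∑ k : Fin n, ((1 - r) / 4 * (2 * (1 / n + c n k))) ^ 2 =
        (1 - r) ^ 2 / 4 * (1 / n + 2 / n * r + ∑ k : Fin n, c n k ^ 2) := by
      have : ∀ k : Fin n, ((1 - r) / 4 * (2 * (1 / n + c n k))) ^ 2 =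
          (1 - r) ^ 2 / 4 * ((1 / n) ^ 2 + 2 / n * c n k + c n k ^ 2) := fun k => by ring
      simp_rw [this]
      rw [← Finset.mul_sum, Finset.sum_add_distrib, Finset.sum_add_distrib, ← Finset.mul_sum,
        hsumc n hn]
      simp only [Finset.sum_const, Finset.card_univ, Fintype.card_fin, nsmul_eq_mul]
      field_simp
    have e2 : ∑ k : Fin n, (-(1 + r) / 4 * (2 * (1 / n - c n k))) ^ 2 =
        (1 + r) ^ 2 / 4 * (1 / n - 2 / n * r + ∑ k : Fin n, c n k ^ 2) := by
      have : ∀ k : Fin n, (-(1 + r) / 4 * (2 * (1 / n - c n k))) ^ 2 =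
          (1 + r) ^ 2 / 4 * ((1 / n) ^ 2 - 2 / n * c n k + c n k ^ 2) := fun k => by ring
      simp_rw [this]
      rw [← Finset.mul_sum, Finset.sum_add_distrib, Finset.sum_sub_distrib, ← Finset.mul_sum,
        hsumc n hn]
      simp only [Finset.sum_const, Finset.card_univ, Fintype.card_fin, nsmul_eq_mul]
      field_simp
    rw [e1, e2]
    field_simp
  refine (hX.isGaussianSubspace.hasQuadraticCGFLimit (ι := fun n => Fin n ⊕ Fin n) hmem hb hbn
    (fun n => by simp; omega) (fun n _ => horth n) hbd hlim).congr ?_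
  filter_upwards [eventually_ge_atTop 1] with n hn
  have hn' : (0 : ℝ) < n := by exact_mod_cast hn
  -- the mean vanishes since `∑ cₖ = r`
  have hmean : ∑ i, a n i * ‖Z n i‖ ^ 2 = 0 := by
    rw [Fintype.sum_sum_type]
    simp only [ha, hZ, Sum.elim_inl, Sum.elim_inr, np, nq]
    rw [← Finset.mul_sum, ← Finset.mul_sum, ← Finset.mul_sum, ← Finset.mul_sum,
      Finset.sum_add_distrib, Finset.sum_sub_distrib, hsumc n hn]
    simp only [Finset.sum_const, Finset.card_univ, Fintype.card_fin, nsmul_eq_mul]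
    field_simp
    ring
  filter_upwards [ae_all_iff.2 fun k => coeFn_incrementLp hX.brownian₁.toIsPreBrownianReal n k,
    ae_all_iff.2 fun k => coeFn_incrementLp hX.brownian₂.toIsPreBrownianReal n k,
    ae_all_iff.2 fun k : ℕ => Lp.coeFn_add (β₁ n k) (β₂ n k),
    ae_all_iff.2 fun k : ℕ => Lp.coeFn_sub (β₁ n k) (β₂ n k)] with ω h1 h2 h3 h4
  rw [hmean, realizedCov_one, realizedVol_one, realizedVol_one, Finset.sum_range,
    Finset.sum_range, Finset.sum_range, Fintype.sum_sum_type, sub_zero, ← Finset.sum_add_distrib,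
    ← Finset.sum_add_distrib]
  congr 1
  rw [Finset.mul_sum, ← Finset.sum_sub_distrib]
  refine Finset.sum_congr rfl fun k _ => ?_
  simp only [ha, hZ, Sum.elim_inl, Sum.elim_inr]
  rw [h3, h4, Pi.add_apply, Pi.sub_apply, hβ₁, hβ₂, h1, h2]
  ring

end RealizedCov

/-! ### The drift -/

section Drift

variable {Ω : Type*} [MeasurableSpace Ω] {P : Measure Ω}

/-- Fubini's theorem turns the essential bound on the product space into bounds along almost every
path. -/
lemma BoundedDrift.exists_bound [SFinite P] {b : ℝ → Ω → ℝ} (h : BoundedDrift P b) :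
    ∃ K : ℝ, 0 ≤ K ∧ ∀ᵐ ω ∂P, IntegrableOn (fun s => b s ω) (Icc 0 1) ∧
      ∀ᵐ s ∂volume.restrict (Icc (0 : ℝ) 1), |b s ω| ≤ K := by
  have h' := h.comp_measurePreserving (Measure.measurePreserving_swap (μ := P)
    (ν := volume.restrict (Icc (0 : ℝ) 1)))
  refine ⟨(eLpNorm (fun p : ℝ × Ω => b p.1 p.2) ∞
    ((volume.restrict (Icc (0 : ℝ) 1)).prod P)).toReal, ENNReal.toReal_nonneg, ?_⟩
  set K := (eLpNorm (fun p : ℝ × Ω => b p.1 p.2) ∞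
    ((volume.restrict (Icc (0 : ℝ) 1)).prod P)).toReal
  have hb : ∀ᵐ p ∂((volume.restrict (Icc (0 : ℝ) 1)).prod P), |b p.1 p.2| ≤ K := by
    have := ae_le_eLpNormEssSup (f := fun p : ℝ × Ω => b p.1 p.2)
      (μ := (volume.restrict (Icc (0 : ℝ) 1)).prod P)
    filter_upwards [this] with p hp
    rw [← eLpNorm_exponent_top] at hp
    have := ENNReal.toReal_mono h.2.ne hp
    rwa [toReal_enorm, Real.norm_eq_abs] at this
  have hb' : ∀ᵐ p ∂(P.prod (volume.restrict (Icc (0 : ℝ) 1))), |b p.2 p.1| ≤ K :=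
    (Measure.measurePreserving_swap (μ := P)
      (ν := volume.restrict (Icc (0 : ℝ) 1))).quasiMeasurePreserving.ae hb
  filter_upwards [Measure.ae_ae_of_ae_prod hb', h'.1.prodMk_left] with ω h1 h2
  exact ⟨Integrable.of_bound h2 K h1, h1⟩

/-- After normalization by the volatility, the increments of the process differ from those of the
driving Brownian motion by the drift, hence by `O(1 / n)`. -/
lemma exists_increment_bound [SFinite P] {B X : ℝ≥0 → Ω → ℝ} (hB : IsPreBrownianReal B P)
    {b : ℝ → Ω → ℝ} (hb : BoundedDrift P b) {σ : ℝ} (hσ : 0 < σ)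
    (h : ∀ t : ℝ≥0, t ≤ 1 → IsWienerIntegral P B (fun _ => σ) t
      (fun ω => X t ω - X 0 ω - ∫ s in (0 : ℝ)..t, b s ω)) :
    ∃ K : ℝ, 0 ≤ K ∧ ∀ᵐ ω ∂P, ∀ n k : ℕ, k < n →
      |increment n X k ω / σ - increment n B k ω| ≤ K / n := by
  obtain ⟨K, hK0, hK⟩ := hb.exists_bound
  refine ⟨K / σ, by positivity, ?_⟩
  have hae : ∀ᵐ ω ∂P, ∀ n k : ℕ, k < n →
      (X (((k : ℝ≥0) + 1) / n) ω - X 0 ω - ∫ s in (0 : ℝ)..(((k : ℝ≥0) + 1) / n : ℝ≥0), b s ω =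
        σ * B (((k : ℝ≥0) + 1) / n) ω) ∧
      (X ((k : ℝ≥0) / n) ω - X 0 ω - ∫ s in (0 : ℝ)..((k : ℝ≥0) / n : ℝ≥0), b s ω =
        σ * B ((k : ℝ≥0) / n) ω) := by
    refine ae_all_iff.2 fun n => ae_all_iff.2 fun k => ?_
    by_cases hk : k < n
    · filter_upwards [(h _ (grid_le_one hk).1).ae_eq_const_mul hB,
        (h _ (grid_le_one hk).2).ae_eq_const_mul hB] with ω h1 h2 _ using ⟨h1, h2⟩
    · exact ae_of_all _ fun ω hk' => absurd hk' hk
  filter_upwards [hK, hae] with ω h1 h2 n k hk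
  obtain ⟨e1, e2⟩ := h2 n k hk
  have hn : (0 : ℝ) < n := by exact_mod_cast (Nat.zero_le k).trans_lt hk
  have hu : (0 : ℝ) ≤ k / n := by positivity
  have huv : (k : ℝ) / n ≤ (k + 1) / n := by gcongr; linarith
  have hv : ((k : ℝ) + 1) / n ≤ 1 := by
    rw [div_le_one hn]; exact_mod_cast hk
  have hii : ∀ u : ℝ, 0 ≤ u → u ≤ 1 → IntervalIntegrable (fun s => b s ω) volume 0 u :=
    fun u h0 h1' => (intervalIntegrable_iff_integrableOn_Ioc_of_le h0).2
      (h1.1.mono_set (Ioc_subset_Icc_self.trans (Icc_subset_Icc_right h1')))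
  push_cast at e1 e2
  have hdiff : (∫ s in (0 : ℝ)..((k + 1) / n), b s ω) - ∫ s in (0 : ℝ)..(k / n), b s ω =
      ∫ s in (k / n : ℝ)..((k + 1) / n), b s ω :=
    intervalIntegral.integral_interval_sub_left (hii _ (hu.trans huv) hv) (hii _ hu (huv.trans hv))
  have hbound : |∫ s in (k / n : ℝ)..((k + 1) / n), b s ω| ≤ K * (1 / n) := by
    have hsub : uIoc (k / n : ℝ) ((k + 1) / n) ⊆ Icc 0 1 := by
      rw [uIoc_of_le huv]
      exact fun x hx => ⟨hu.trans hx.1.le, hx.2.trans hv⟩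
    have := intervalIntegral.norm_integral_le_of_norm_le_const_ae (C := K)
      (f := fun s => b s ω) (a := (k / n : ℝ)) (b := (k + 1) / n) (by
        filter_upwards [(ae_restrict_iff' measurableSet_Icc).1 h1.2] with x hx hx'
        exact hx (hsub hx'))
    rw [Real.norm_eq_abs] at this
    have e : ((k : ℝ) + 1) / n - k / n = 1 / n := by ring
    rwa [e, abs_of_pos (show (0 : ℝ) < 1 / n by positivity)] at this
  have hX : increment n X k ω / σ - increment n B k ω =
      (∫ s in (k / n : ℝ)..((k + 1) / n), b s ω) / σ := by
    rw [← hdiff, increment, increment]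
    field_simp
    linear_combination e1 - e2
  rw [hX, abs_div, abs_of_pos hσ]
  calc |∫ s in (k / n : ℝ)..((k + 1) / n), b s ω| / σ ≤ K * (1 / n) / σ := by gcongr
    _ = K / σ / n := by ring

lemma sum_abs_le_of_sum_sq_le {n : ℕ} {x : ℕ → ℝ} (hx : ∑ k ∈ Finset.range n, x k ^ 2 ≤ 2) :
    ∑ k ∈ Finset.range n, |x k| ≤ 2 * √n := by
  have h := sq_sum_le_card_mul_sum_sq (s := Finset.range n) (f := fun k => |x k|)
  simp only [sq_abs, Finset.card_range] at h
  have hs : √(n : ℝ) ^ 2 = n := Real.sq_sqrt (Nat.cast_nonneg n)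
  refine abs_le_of_sq_le_sq' ?_ (by positivity) |>.2
  have hn : (0 : ℝ) ≤ n := Nat.cast_nonneg n
  nlinarith

/-- A perturbation of size `K / n` of the increments changes the realized covolatility by
`O(1 / √n)`. -/
lemma abs_sum_mul_sub_sum_mul_le {n : ℕ} (hn : 1 ≤ n) {K : ℝ} (hK : 0 ≤ K) {x y x' y' : ℕ → ℝ}
    (hx : ∑ k ∈ Finset.range n, x k ^ 2 ≤ 2) (hy : ∑ k ∈ Finset.range n, y k ^ 2 ≤ 2)
    (hx' : ∀ k < n, |x' k - x k| ≤ K / n) (hy' : ∀ k < n, |y' k - y k| ≤ K / n) :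
    |∑ k ∈ Finset.range n, x' k * y' k - ∑ k ∈ Finset.range n, x k * y k| ≤
      (4 * K + K ^ 2) / √n := by
  have hn' : (1 : ℝ) ≤ n := by exact_mod_cast hn
  have hs : 0 < √(n : ℝ) := Real.sqrt_pos.2 (by linarith)
  have hss : √(n : ℝ) ^ 2 = n := Real.sq_sqrt (by linarith)
  have hs1 : 1 ≤ √(n : ℝ) := Real.one_le_sqrt.2 hn'
  rw [← Finset.sum_sub_distrib]
  have hterm : ∀ k ∈ Finset.range n, |x' k * y' k - x k * y k| ≤
      K / n * |x k| + K / n * |y k| + (K / n) ^ 2 := by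
    intro k hk
    have h1 := hx' k (Finset.mem_range.1 hk)
    have h2 := hy' k (Finset.mem_range.1 hk)
    have e : x' k * y' k - x k * y k =
        x k * (y' k - y k) + (x' k - x k) * y k + (x' k - x k) * (y' k - y k) := by ring
    rw [e]
    refine (abs_add_three _ _ _).trans ?_
    rw [abs_mul, abs_mul, abs_mul]
    have := mul_le_mul_of_nonneg_left h2 (abs_nonneg (x k))
    have := mul_le_mul_of_nonneg_right h1 (abs_nonneg (y k))
    have := mul_le_mul h1 h2 (abs_nonneg _) (by positivity)
    nlinarith
  refine (Finset.abs_sum_le_sum_abs _ _).trans ((Finset.sum_le_sum hterm).trans ?_)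
  rw [Finset.sum_add_distrib, Finset.sum_add_distrib, ← Finset.mul_sum, ← Finset.mul_sum,
    Finset.sum_const, Finset.card_range, nsmul_eq_mul]
  have h1 := sum_abs_le_of_sum_sq_le hx
  have h2 := sum_abs_le_of_sum_sq_le hy
  calc K / n * ∑ k ∈ Finset.range n, |x k| + K / n * ∑ k ∈ Finset.range n, |y k| + n * (K / n) ^ 2
      ≤ K / n * (2 * √n) + K / n * (2 * √n) + n * (K / n) ^ 2 := by gcongr
    _ = 4 * K / √n + K ^ 2 / (√n * √n) := by
        have E : ∀ s z : ℝ, 0 < s → z = s ^ 2 → K / z * (2 * s) + K / z * (2 * s) +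
            z * (K / z) ^ 2 = 4 * K / s + K ^ 2 / (s * s) := by
          rintro s _ hs rfl; field_simp; ring
        exact E _ _ hs hss.symm
    _ ≤ 4 * K / √n + K ^ 2 / (1 * √n) := by gcongr
    _ = (4 * K + K ^ 2) / √n := by rw [one_mul, add_div]

end Drift

/-! ### Linearization of the correlation -/

section Delta

/-- The second-order remainder of the map `(q₁, q₂, c) ↦ c / √(q₁ q₂)` at `(1, 1, r)`. -/
lemma abs_div_sqrt_sub_linear_le {q₁ q₂ c r h : ℝ} (h1 : |q₁ - 1| ≤ h) (h2 : |q₂ - 1| ≤ h)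
    (hc : |c - r| ≤ h) (hr : |r| ≤ 1) (hh : h ≤ 1 / 2) :
    |c / √(q₁ * q₂) - r - ((c - r) - r / 2 * ((q₁ - 1) + (q₂ - 1)))| ≤ 20 * h ^ 2 := by
  have hh0 : 0 ≤ h := (abs_nonneg _).trans h1
  have a1 := abs_le.1 h1
  have a2 := abs_le.1 h2
  have hq : 1 / 4 ≤ q₁ * q₂ := by nlinarith
  set s := √(q₁ * q₂) with hs
  have hss : s ^ 2 = q₁ * q₂ := Real.sq_sqrt (by linarith)
  have hs2 : 1 / 2 ≤ s := Real.le_sqrt_of_sq_le (by linarith)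
  have hs0 : 0 < s := by linarith
  set e := q₁ * q₂ - 1 with he
  have hee : |(q₁ - 1) * (q₂ - 1)| ≤ h ^ 2 := by
    rw [abs_mul, sq]
    exact mul_le_mul h1 h2 (abs_nonneg _) hh0
  have heabs : |e| ≤ 5 / 2 * h := by
    have : e = (q₁ - 1) + (q₂ - 1) + (q₁ - 1) * (q₂ - 1) := by rw [he]; ring
    rw [this]
    refine (abs_add_three _ _ _).trans ?_
    nlinarith
  have hs1 : |s - 1| ≤ 5 / 3 * h := by
    have : s - 1 = e / (s + 1) := by
      rw [eq_div_iff (by linarith), he, ← hss]; ring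
    rw [this, abs_div, abs_of_pos (by linarith : 0 < s + 1), div_le_iff₀ (by linarith)]
    nlinarith
  have hu1 : |1 / s - 1| ≤ 10 / 3 * h := by
    have : 1 / s - 1 = -(s - 1) / s := by field_simp; ring
    rw [this, abs_div, abs_neg, abs_of_pos hs0, div_le_iff₀ hs0]
    nlinarith
  have hu2 : |1 / s - 1 + ((q₁ - 1) + (q₂ - 1)) / 2| ≤ 9 * h ^ 2 := by
    have : 1 / s - 1 + ((q₁ - 1) + (q₂ - 1)) / 2 =
        (s - 1) ^ 2 * ((s + 2) / (2 * s)) - (q₁ - 1) * (q₂ - 1) / 2 := by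
      have : (q₁ - 1) + (q₂ - 1) = s ^ 2 - 1 - (q₁ - 1) * (q₂ - 1) := by rw [hss]; ring
      rw [this]; field_simp; ring
    rw [this]
    have k1 : (s + 2) / (2 * s) ≤ 5 / 2 := by
      rw [div_le_iff₀ (by linarith)]; linarith
    have k2 : (s - 1) ^ 2 ≤ (5 / 3 * h) ^ 2 := by
      rw [← sq_abs]; gcongr
    have k3 : 0 ≤ (s + 2) / (2 * s) := by positivity
    have k4 : (s - 1) ^ 2 * ((s + 2) / (2 * s)) ≤ (5 / 3 * h) ^ 2 * (5 / 2) := by gcongr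
    have k5 : 0 ≤ (s - 1) ^ 2 * ((s + 2) / (2 * s)) := by positivity
    have k6 := abs_le.1 hee
    rw [abs_le]
    constructor <;> nlinarith [sq_nonneg h]
  have e1 : c / s - r - ((c - r) - r / 2 * ((q₁ - 1) + (q₂ - 1))) =
      (c - r) * (1 / s - 1) + r * (1 / s - 1 + ((q₁ - 1) + (q₂ - 1)) / 2) := by
    field_simp; ring
  rw [e1]
  refine (abs_add_le _ _).trans ?_
  rw [abs_mul, abs_mul]
  have m1 : |c - r| * |1 / s - 1| ≤ h * (10 / 3 * h) := by gcongr
  have m2 : |r| * |1 / s - 1 + ((q₁ - 1) + (q₂ - 1)) / 2| ≤ 1 * (9 * h ^ 2) := by gcongr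
  nlinarith [sq_nonneg h]

variable {Ω : Type*} [MeasurableSpace Ω] {P : Measure Ω}

/-- Exponential tightness: the tails can be made negligible at any rate `K`. -/
lemma HasQuadraticCGFLimit.exists_tail_le [IsProbabilityMeasure P] {L : ℕ → Ω → ℝ} {a : ℕ → ℝ}
    {v : ℝ} (h : HasQuadraticCGFLimit P L a v) (ha : Tendsto a atTop atTop) (hv : 0 < v) {K : ℝ}
    (hK : 0 ≤ K) : ∃ R₀ : ℝ, ∀ R, R₀ ≤ R → ∀ᶠ n in atTop,
      P {ω | R ≤ |L n ω|} ≤ ENNReal.ofReal (Real.exp (-(a n * K))) := by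
  refine ⟨√(2 * v * (K + 1)), fun R hR => ?_⟩
  have hpos : 0 < √(2 * v * (K + 1)) := by positivity
  filter_upwards [h.abs_tail ha hv hpos one_pos] with n hn
  rw [Real.sq_sqrt (by positivity), mul_div_cancel_left₀ _ (by positivity),
    add_sub_cancel_right] at hn
  refine (measure_mono (t := {ω | √(2 * v * (K + 1)) ≤ |L n ω|}) fun ω hω =>
    hR.trans hω).trans ?_
  rw [← ofReal_measureReal (measure_ne_top _ _)]
  exact ENNReal.ofReal_le_ofReal hn

/-- Scaling each coordinate does not change the realized correlation. -/
lemma realizedCorr_one_eq {Ω : Type*} {X₁ X₂ : ℝ≥0 → Ω → ℝ} {s t : ℝ} (hs : 0 < s) (ht : 0 < t)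
    (n : ℕ) (ω : Ω) : realizedCorr n 1 X₁ X₂ ω =
      (∑ k ∈ Finset.range n, increment n X₁ k ω / s * (increment n X₂ k ω / t)) /
        √((∑ k ∈ Finset.range n, increment n X₁ k ω / s * (increment n X₁ k ω / s)) *
          ∑ k ∈ Finset.range n, increment n X₂ k ω / t * (increment n X₂ k ω / t)) := by
  rw [realizedCorr, realizedCov_one, realizedVol_one, realizedVol_one]
  have e : ∀ (x y : ℕ → ℝ) (p q : ℝ), ∑ k ∈ Finset.range n, x k / p * (y k / q) =
      (∑ k ∈ Finset.range n, x k * y k) / (p * q) := by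
    intro x y p q
    rw [Finset.sum_div]
    exact Finset.sum_congr rfl fun k _ => div_mul_div_comm _ _ _ _
  rw [e, e, e]
  simp only [← sq]
  rw [div_mul_div_comm, ← mul_pow, Real.sqrt_div' _ (by positivity),
    Real.sqrt_sq (by positivity), div_div_div_cancel_right₀ (by positivity)]

/-- The deterministic estimate behind the exponential equivalence: on the event where the three
Brownian statistics are at most `R`, the normalized realized correlation of the process differs
from its linearization by `O(b / √n + 1 / b)`. -/
lemma abs_scaled_corr_sub_linear_le {n : ℕ} (hn : 1 ≤ n) {b K R r : ℝ} (hb : 1 ≤ b) (hK : 0 ≤ K)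
    (hR : 0 ≤ R) (hr : |r| ≤ 1) {x y x' y' : ℕ → ℝ}
    (hx' : ∀ k < n, |x' k - x k| ≤ K / n) (hy' : ∀ k < n, |y' k - y k| ≤ K / n)
    (hsmall : (2 * R + (4 * K + K ^ 2)) * (b / √n) ≤ 1 / 2)
    (h1 : |√n / b * (∑ k ∈ Finset.range n, x k ^ 2 - 1)| ≤ R)
    (h2 : |√n / b * (∑ k ∈ Finset.range n, y k ^ 2 - 1)| ≤ R)
    (h3 : |√n / b * (∑ k ∈ Finset.range n, x k * y k -
      r / 2 * (∑ k ∈ Finset.range n, x k ^ 2 + ∑ k ∈ Finset.range n, y k ^ 2))| ≤ R) :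
    |√n / b * ((∑ k ∈ Finset.range n, x' k * y' k) /
        √((∑ k ∈ Finset.range n, x' k * x' k) * ∑ k ∈ Finset.range n, y' k * y' k) - r) -
      √n / b * (∑ k ∈ Finset.range n, x k * y k -
        r / 2 * (∑ k ∈ Finset.range n, x k ^ 2 + ∑ k ∈ Finset.range n, y k ^ 2))| ≤
      20 * (2 * R + (4 * K + K ^ 2)) ^ 2 * (b / √n) + 2 * (4 * K + K ^ 2) / b := by
  have hn' : (1 : ℝ) ≤ n := by exact_mod_cast hn
  have hs : 0 < √(n : ℝ) := Real.sqrt_pos.2 (by linarith)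
  have hb0 : 0 < b := by linarith
  set D := 4 * K + K ^ 2 with hD
  have hD0 : 0 ≤ D := by positivity
  set z := b / √(n : ℝ) with hz
  have hz0 : 0 < z := by positivity
  have hzi : √(n : ℝ) / b = z⁻¹ := by rw [hz, inv_div]
  rw [hzi] at h1 h2 h3 ⊢
  set q₁ := ∑ k ∈ Finset.range n, x k ^ 2
  set q₂ := ∑ k ∈ Finset.range n, y k ^ 2
  set c := ∑ k ∈ Finset.range n, x k * y k
  rw [abs_mul, abs_of_pos (inv_pos.2 hz0), inv_mul_le_iff₀ hz0] at h1 h2 h3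
  have a1 := abs_le.1 h1
  have a2 := abs_le.1 h2
  have hRz : R * z ≤ 1 / 4 := by nlinarith
  have hDn : D / √n ≤ D * z := by
    rw [hz, ← mul_div_assoc]
    gcongr
    nlinarith
  have hx : q₁ ≤ 2 := by nlinarith
  have hy : q₂ ≤ 2 := by nlinarith
  have d1 := (abs_sum_mul_sub_sum_mul_le hn hK hx hx hx' hx')
  have d2 := (abs_sum_mul_sub_sum_mul_le hn hK hy hy hy' hy')
  have d3 := (abs_sum_mul_sub_sum_mul_le hn hK hx hy hx' hy')
  rw [show ∑ k ∈ Finset.range n, x k * x k = q₁ from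
    Finset.sum_congr rfl fun k _ => (sq (x k)).symm] at d1
  rw [show ∑ k ∈ Finset.range n, y k * y k = q₂ from
    Finset.sum_congr rfl fun k _ => (sq (y k)).symm] at d2
  set q₁' := ∑ k ∈ Finset.range n, x' k * x' k
  set q₂' := ∑ k ∈ Finset.range n, y' k * y' k
  set c' := ∑ k ∈ Finset.range n, x' k * y' k
  change |c' - c| ≤ D / √n at d3
  have hc : |c - r| ≤ 2 * R * z := by
    have e : c - r = (c - r / 2 * (q₁ + q₂)) + r * ((q₁ - 1 + (q₂ - 1)) / 2) := by ring
    rw [e]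
    refine (abs_add_le _ _).trans ?_
    rw [abs_mul]
    have k1 : |(q₁ - 1 + (q₂ - 1)) / 2| ≤ R * z := by
      rw [abs_le]; constructor <;> linarith
    have k2 := mul_le_mul hr k1 (abs_nonneg _) zero_le_one
    linarith
  set h := (2 * R + D) * z with hh
  have hRz0 : 0 ≤ R * z := by positivity
  have b1 : |q₁' - 1| ≤ h := by
    have := abs_sub_le q₁' q₁ 1
    rw [hh]; linarith
  have b2 : |q₂' - 1| ≤ h := by
    have := abs_sub_le q₂' q₂ 1
    rw [hh]; linarith
  have b3 : |c' - r| ≤ h := by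
    have := abs_sub_le c' c r
    rw [hh]; linarith
  have hdelta := abs_div_sqrt_sub_linear_le b1 b2 b3 hr hsmall
  rw [← mul_sub, abs_mul, abs_of_pos (inv_pos.2 hz0), inv_mul_le_iff₀ hz0]
  have e : c' / √(q₁' * q₂') - r - (c - r / 2 * (q₁ + q₂)) =
      (c' / √(q₁' * q₂') - r - ((c' - r) - r / 2 * ((q₁' - 1) + (q₂' - 1)))) +
      ((c' - c) + -r * (((q₁' - q₁) + (q₂' - q₂)) / 2)) := by ring
  rw [e]
  refine (abs_add_le _ _).trans ?_
  have k1 : |(c' - c) + -r * (((q₁' - q₁) + (q₂' - q₂)) / 2)| ≤ 2 * (D / √n) := by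
    refine (abs_add_le _ _).trans ?_
    rw [abs_mul, abs_neg]
    have k2 : |((q₁' - q₁) + (q₂' - q₂)) / 2| ≤ D / √n := by
      have := abs_le.1 d1
      have := abs_le.1 d2
      rw [abs_le]; constructor <;> linarith
    have k3 := mul_le_mul hr k2 (abs_nonneg _) zero_le_one
    linarith
  have k4 : z * (20 * (2 * R + D) ^ 2 * z + 2 * D / b) = 20 * h ^ 2 + 2 * (D / √n) := by
    rw [hh, mul_add]
    congr 1
    · ring
    · rw [hz]; field_simp
  rw [k4]
  linarith

end Delta

/-! ### Exponential equivalence and the large deviation principle -/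

section Assembly

variable {Ω : Type*} [MeasurableSpace Ω] {P : Measure Ω} [IsProbabilityMeasure P]
    {B₁ B₂ B₃ : ℝ≥0 → Ω → ℝ} {σ₁ σ₂ : ℝ} {ρ : ℝ → ℝ} {b₁ b₂ : ℝ → Ω → ℝ}
    {X₁ X₂ : ℝ≥0 → Ω → ℝ} {b : ℕ → ℝ}

/-- The normalized realized correlation is exponentially equivalent to the linearized statistic of
the driving Brownian motions. -/
lemma IsBivariateIto.expEquiv
    (hX : IsBivariateIto P B₁ B₂ B₃ (fun _ => σ₁) (fun _ => σ₂) ρ b₁ b₂ X₁ X₂)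
    (hb : Tendsto b atTop atTop) (hbn : Tendsto (fun n : ℕ => b n / √n) atTop (𝓝 0))
    (hB₁ : BoundedDrift P b₁) (hB₂ : BoundedDrift P b₂) {r m : ℝ}
    (hr : r = ∫ x in (0 : ℝ)..1, ρ x) (hm : m = ∫ x in (0 : ℝ)..1, ρ x ^ 2) (hr1 : |r| < 1)
    (hrm : r ^ 2 ≤ m) (δ C : ℝ) (hδ : 0 < δ) :
    ∀ᶠ n : ℕ in atTop, P {ω | δ ≤ |√(n : ℝ) / b n * (realizedCorr n 1 X₁ X₂ ω - r) -
      √(n : ℝ) / b n * (realizedCov n 1 B₁ B₂ ω -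
        r / 2 * (realizedVol n 1 B₁ ω + realizedVol n 1 B₂ ω))|} ≤
      ENNReal.ofReal (Real.exp (-(b n ^ 2 * C))) := by
  have hσ₁ : 0 < σ₁ := hX.vol_pos₁ 0 (by simp)
  have hσ₂ : 0 < σ₂ := hX.vol_pos₂ 0 (by simp)
  have ha : Tendsto (fun n => b n ^ 2) atTop atTop := (tendsto_pow_atTop two_ne_zero).comp hb
  -- the spare rate `2` absorbs the three terms of the union bound
  have hC : (0 : ℝ) ≤ |C| + 2 := by positivity
  obtain ⟨R₁, hR₁⟩ := (hasQuadraticCGFLimit_realizedVol hX.brownian₁.toIsPreBrownianReal hb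
    hbn).exists_tail_le ha two_pos hC
  obtain ⟨R₂, hR₂⟩ := (hasQuadraticCGFLimit_realizedVol hX.brownian₂.toIsPreBrownianReal hb
    hbn).exists_tail_le ha two_pos hC
  obtain ⟨R₃, hR₃⟩ := (hX.hasQuadraticCGFLimit hb hbn hr hm hr1.le).exists_tail_le ha
    (corrVariance_pos hr1 hrm) hC
  obtain ⟨K₁, hK₁, hd₁⟩ := exists_increment_bound hX.brownian₁.toIsPreBrownianReal hB₁ hσ₁ hX.sde₁
  obtain ⟨K₂, hK₂, hd₂⟩ := exists_increment_bound hX.brownian₂.toIsPreBrownianReal hB₂ hσ₂ hX.sde₂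
  set R := max 0 (max R₁ (max R₂ R₃)) with hR
  set K := max K₁ K₂ with hK
  have hR0 : 0 ≤ R := le_max_left _ _
  have hK0 : 0 ≤ K := hK₁.trans (le_max_left _ _)
  set A := 2 * R + (4 * K + K ^ 2) with hA
  have t1 : Tendsto (fun n : ℕ => A * (b n / √n)) atTop (𝓝 0) := by
    simpa using hbn.const_mul A
  have t2 : Tendsto (fun n : ℕ => 20 * A ^ 2 * (b n / √n) + 2 * (4 * K + K ^ 2) / b n) atTop
      (𝓝 0) := by
    simpa using (hbn.const_mul (20 * A ^ 2)).add (tendsto_const_nhds.div_atTop hb)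
  filter_upwards [hR₁ R (by simp [hR]), hR₂ R (by simp [hR]), hR₃ R (by simp [hR]),
    t1.eventually_le_const (show (0 : ℝ) < 1 / 2 by norm_num), t2.eventually_lt_const hδ,
    hb.eventually_ge_atTop 1, eventually_ge_atTop 1] with n p1 p2 p3 q1 q2 hb1 hn
  have hsub : {ω | δ ≤ |√(n : ℝ) / b n * (realizedCorr n 1 X₁ X₂ ω - r) -
      √(n : ℝ) / b n * (realizedCov n 1 B₁ B₂ ω -
        r / 2 * (realizedVol n 1 B₁ ω + realizedVol n 1 B₂ ω))|} ≤ᵐ[P]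
      ({ω | R ≤ |√(n : ℝ) / b n * (realizedVol n 1 B₁ ω - 1)|} ∪
        ({ω | R ≤ |√(n : ℝ) / b n * (realizedVol n 1 B₂ ω - 1)|} ∪
        {ω | R ≤ |√(n : ℝ) / b n * (realizedCov n 1 B₁ B₂ ω -
          r / 2 * (realizedVol n 1 B₁ ω + realizedVol n 1 B₂ ω))|}) : Set Ω) := by
    filter_upwards [hd₁, hd₂] with ω e1 e2 (hω : δ ≤ _)
    by_contra hcon
    have hcon' : ¬ (R ≤ |√(n : ℝ) / b n * (realizedVol n 1 B₁ ω - 1)| ∨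
      (R ≤ |√(n : ℝ) / b n * (realizedVol n 1 B₂ ω - 1)| ∨
      R ≤ |√(n : ℝ) / b n * (realizedCov n 1 B₁ B₂ ω -
          r / 2 * (realizedVol n 1 B₁ ω + realizedVol n 1 B₂ ω))|)) := hcon
    simp only [not_or, not_le] at hcon'
    obtain ⟨c1, c2, c3⟩ := hcon'
    rw [realizedCorr_one_eq hσ₁ hσ₂] at hω
    rw [realizedCov_one, realizedVol_one, realizedVol_one] at hω c3
    rw [realizedVol_one] at c1 c2
    have := abs_scaled_corr_sub_linear_le hn hb1 hK0 hR0 hr1.le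
      (x' := fun k => increment n X₁ k ω / σ₁) (y' := fun k => increment n X₂ k ω / σ₂)
      (x := fun k => increment n B₁ k ω) (y := fun k => increment n B₂ k ω)
      (fun k hk => (e1 n k hk).trans (by gcongr; exact le_max_left _ _))
      (fun k hk => (e2 n k hk).trans (by gcongr; exact le_max_right _ _))
      q1 c1.le c2.le c3.le
    linarith
  refine (measure_mono_ae hsub).trans ((measure_union_le _ _).trans
    ((add_le_add p1 ((measure_union_le _ _).trans (add_le_add p2 p3))).trans ?_))
  rw [← ENNReal.ofReal_add (Real.exp_pos _).le (Real.exp_pos _).le,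
    ← ENNReal.ofReal_add (Real.exp_pos _).le (by positivity)]
  apply ENNReal.ofReal_le_ofReal
  have hbb : 1 ≤ b n ^ 2 := one_le_pow₀ hb1
  have e1 : -(b n ^ 2 * C) = -(b n ^ 2 * (|C| + 2)) + b n ^ 2 * (|C| - C + 2) := by ring
  have e2 : 2 ≤ b n ^ 2 * (|C| - C + 2) := by nlinarith [le_abs_self C]
  have e3 := Real.add_one_le_exp (b n ^ 2 * (|C| - C + 2))
  rw [e1, Real.exp_add]
  nlinarith [Real.exp_pos (-(b n ^ 2 * (|C| + 2)))]

end Assembly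

theorem mainTheorem9 {Ω : Type*} [MeasurableSpace Ω] (P : Measure Ω) [IsProbabilityMeasure P]
    (B₁ B₂ B₃ : ℝ≥0 → Ω → ℝ) (σ₁ σ₂ : ℝ) (ρ : ℝ → ℝ) (b₁ b₂ : ℝ → Ω → ℝ)
    (X₁ X₂ : ℝ≥0 → Ω → ℝ) (b : ℕ → ℝ)
    (hX : IsBivariateIto P B₁ B₂ B₃ (fun _ => σ₁) (fun _ => σ₂) ρ b₁ b₂ X₁ X₂)
    (hMDP : MDPCondition (fun _ => σ₁) (fun _ => σ₂) ρ b)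
    (hB₁ : BoundedDrift P b₁) (hB₂ : BoundedDrift P b₂) :
    SatisfiesLDP P
      (fun n ω => √(n : ℝ) / b n * (realizedCorr n 1 X₁ X₂ ω - ∫ t in (0 : ℝ)..1, ρ t))
      (fun n => b n ^ 2)
      (rateCorr σ₁ σ₂ ρ) := by
  have hb := hMDP.tendsto_atTop
  have hbn := hMDP.tendsto_div_sqrt
  have hσ₁ : 0 < σ₁ := hX.vol_pos₁ 0 (by simp)
  have hσ₂ : 0 < σ₂ := hX.vol_pos₂ 0 (by simp)
  have hρ : IntervalIntegrable ρ volume 0 1 :=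
    (intervalIntegrable_iff_integrableOn_Ioc_of_le zero_le_one).2 hX.integrableOn_corr
  have hρ2 : IntervalIntegrable (fun x => ρ x ^ 2) volume 0 1 :=
    (intervalIntegrable_iff_integrableOn_Ioc_of_le zero_le_one).2 hX.memLp_corr.integrable_sq
  set r := ∫ t in (0 : ℝ)..1, ρ t with hr
  obtain ⟨m, hm⟩ : ∃ m, m = ∫ x in (0 : ℝ)..1, ρ x ^ 2 := ⟨_, rfl⟩
  have hm1 : m ≤ 1 := by
    have := intervalIntegral.integral_mono_on_of_le_Ioo (g := fun _ => (1 : ℝ)) zero_le_one hρ2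
      (by simp) fun x hx => ((sq_le_one_iff_abs_le_one _).2
        (hX.abs_corr_lt ⟨hx.1, hx.2.le⟩).le)
    simpa [← hm] using this
  have hrm : r ^ 2 ≤ m := by
    have h0 : 0 ≤ ∫ x in (0 : ℝ)..1, (ρ x - r) ^ 2 :=
      intervalIntegral.integral_nonneg zero_le_one fun x _ => sq_nonneg _
    have e : ∫ x in (0 : ℝ)..1, (ρ x - r) ^ 2 = m - r ^ 2 := by
      have e1 : ∀ x, (ρ x - r) ^ 2 = ρ x ^ 2 - 2 * r * ρ x + r ^ 2 := fun x => by ring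
      simp_rw [e1]
      rw [intervalIntegral.integral_add (hρ2.sub (hρ.const_mul _)) (by simp),
        intervalIntegral.integral_sub hρ2 (hρ.const_mul _), intervalIntegral.integral_const_mul,
        ← hm, ← hr, intervalIntegral.integral_const]
      simp
      ring
    linarith
  have hr1 : |r| < 1 := by
    -- strictness comes from `|ρ| < 1` everywhere
    have hlt : ∀ g : ℝ → ℝ, IntervalIntegrable g volume 0 1 → (∀ x ∈ Ioc (0 : ℝ) 1, g x < 1) →
        ∫ x in (0 : ℝ)..1, g x < 1 := by
      intro g hg h
      have := intervalIntegral.intervalIntegral_pos_of_pos_on (f := fun x => 1 - g x)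
        ((by simp : IntervalIntegrable (fun _ => (1 : ℝ)) volume 0 1).sub hg)
        (fun x hx => sub_pos.2 (h x ⟨hx.1, hx.2.le⟩)) zero_lt_one
      rw [intervalIntegral.integral_sub (by simp) hg] at this
      simp at this
      linarith
    rw [abs_lt]
    constructor
    · have := hlt (fun x => -ρ x) hρ.neg fun x hx => by
        linarith [(abs_lt.1 (hX.abs_corr_lt hx)).1]
      rw [intervalIntegral.integral_neg] at this
      linarith
    · exact hlt ρ hρ fun x hx => (abs_lt.1 (hX.abs_corr_lt hx)).2
  have hrate : rateCorr σ₁ σ₂ ρ = fun u => ENNReal.ofReal (u ^ 2 / (2 * corrVariance r m)) :=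
    funext fun u => rateCorr_eq hσ₁ hσ₂ hρ2 hr hm hr1 hrm hm1 u
  rw [hrate]
  refine (hX.hasQuadraticCGFLimit hb hbn hr hm hr1.le).satisfiesLDP_of_expEquiv (fun n => ?_)
    ((tendsto_pow_atTop two_ne_zero).comp hb) (corrVariance_pos hr1 hrm)
    (fun δ C hδ => hX.expEquiv hb hbn hB₁ hB₂ hr hm hr1 hrm δ C hδ)
  have m1 : ∀ k, AEMeasurable (increment n B₁ k) P := fun k =>
    (hX.brownian₁.aemeasurable _).sub (hX.brownian₁.aemeasurable _)
  have m2 : ∀ k, AEMeasurable (increment n B₂ k) P := fun k =>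
    (hX.brownian₂.aemeasurable _).sub (hX.brownian₂.aemeasurable _)
  simp only [realizedCov_one, realizedVol_one]
  fun_prop
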